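/- Let $p\neq\ell$ be odd primes, $q$ a power of $p$, $m\ge 1$, $n\ge 0$, $N=2\ell^m p^n$, and assume $\gcd(\ell,q-1)=1$. Let $\mathbb F_q^*=\langle\xi\rangle$. In an extension field $K$ of $\mathbb F_q$ let $\eta$ be a primitive $\ell^m$-th root of unity, $\alpha_1$ an element with $\alpha_1^2=\xi$, and $\beta_1$ the primitive $2(q-1)$-th root of unity with $\beta_1^{\ell^m}\alpha_1=1$. Let $f$ be the multiplicative order of $q$ modulo $\ell$. Let $\rho_0=0,\rho_1,\dots,\rho_e$ be representatives of all the distinct $q$-cyclotomic cosets $\{t,tq,tq^2,\dots\}$ modulo $\ell^m$. For $t\in\mathbb Z/\ell^m$ let $M_t(X)\in\mathbb F_q[X]$ be the minimal polynomial of $\eta^t$ over $\mathbb F_q$, and $N_t(X)=\prod_{s\in D_t}(X-\eta^s)$, where $D_t=\{t,tq^2,tq^4,\dots\}$ is the $q^2$-cyclotomic coset of $t$ modulo $\ell^m$. For a nonzero polynomial $g$ and $c\ne 0$, $\hat g(cX)$ denotes the monic scalar multiple of $g(cX)$. Put $$S_i(X)=\hat M_{\rho_i}(\beta_1X)\hat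 M_{\rho_i}(-\beta_1X),\qquad S_{-i}(X)=\hat M_{-\rho_i}(\beta_1^{-1}X)\hat M_{-\rho_i}(-\beta_1^{-1}X)\qquad(0\le i\le e),$$ $$P(X)=(X-\beta_1^{-1})(X+\beta_1^{-1}),\qquad P^*(X)=(X-\beta_1)(X+\beta_1),$$ and for $1\le i\le e$ $$Q_i(X)=\hat N_{\rho_i}(\beta_1X)\hat N_{\rho_iq}(-\beta_1X),\qquad R_i(X)=\hat N_{\rho_iq}(\beta_1X)\hat N_{\rho_i}(-\beta_1X),$$ $$Q_{-i}(X)=\hat N_{-\rho_i}(\beta_1^{-1}X)\hat N_{-\rho_iq}(-\beta_1^{-1}X),\qquad R_{-i}(X)=\hat N_{-\rho_iq}(\beta_1^{-1}X)\hat N_{-\rho_i}(-\beta_1^{-1}X).$$ For $\lambda\in\mathbb F_q^*$, a linear code $C\subseteq\mathbb F_q^N$ is $\lambda$-constacyclic if $(\lambda c_{N-1},c_0,\dots,c_{N-2})\in C$ for all $(c_0,\dots,c_{N-1})\in C$. We write $C=\langle g(X)\rangle$ if $g\in\mathbb F_q[X]$ is a monic divisor of $X^N-\lambda$ and $C$ consists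 of the words $c$ for which $\sum_i c_iX^i$ lies in the ideal of $\mathbb F_q[X]/\langle X^N-\lambda\rangle$ generated by $g$. Let $C^\perp$ be the dual of $C$ for the standard Euclidean inner product. Let $\lambda\in\mathbb F_q^*$. **(A)** If $\lambda\in\langle\xi^2\rangle$, then there is $a\in\mathbb F_q^*$ with $a^{N}\lambda=1$, and for every such $a$ every $\lambda$-constacyclic code $C$ of length $N$ is of the form $$C=\Big\langle\prod_{i=0}^e\hat M_{\rho_i}(aX)^{\varepsilon_i}\hat M_{\rho_i}(-aX)^{\epsilon_i}\Big\rangle,\qquad 0\le\varepsilon_i,\epsilon_i\le p^n.$$ Whenever $C$ is so presented, $C^\perp$ is the $\lambda^{-1}$-constacyclic code $$C^\perp=\Big\langle\prod_{i=0}^e\hat M_{-\rho_i}(a^{-1}X)^{p^n-\varepsilon_i}\hat M_{-\rho_i}(-a^{-1}X)^{p^n-\epsilon_i}\Big\rangle.$$ **(B)** If $\lambda\notin\langle\xi^2\rangle$, then there is $b\in\mathbb F_q^*$ with $b^{N}\lambda=\xi^{p^n}$, and for every such $b$ and every $\lambda$-constacyclic code $C$ of length $N$ the following hold (in particular, all the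 generators displayed have their coefficients in $\mathbb F_q$). **(B1)** If $f$ is odd, then $C=\big\langle\prod_{i=0}^e\hat S_i(bX)^{\varepsilon_i}\big\rangle$ for some $0\le\varepsilon_i\le p^n$; and whenever $C$ is so presented, $C^\perp$ is the $\lambda^{-1}$-constacyclic code $$C^\perp=\Big\langle\prod_{i=0}^e\hat S_{-i}(b^{-1}X)^{p^n-\varepsilon_i}\Big\rangle.$$ **(B2)** If $f$ is even, then $C=\big\langle\hat P(bX)^{\varepsilon}\prod_{i=1}^e\hat Q_i(bX)^{\varepsilon_i}\hat R_i(bX)^{\epsilon_i}\big\rangle$ for some $0\le\varepsilon,\varepsilon_i,\epsilon_i\le p^n$; and whenever $C$ is so presented, $C^\perp$ is the $\lambda^{-1}$-constacyclic code $$C^\perp=\Big\langle\hat P^*(b^{-1}X)^{p^n-\varepsilon}\prod_{i=1}^e\hat Q_{-i}(b^{-1}X)^{p^n-\varepsilon_i}\hat R_{-i}(b^{-1}X)^{p^n-\epsilon_i}\Big\rangle.$$ -/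

import Mathlib

open Polynomial

/-- The dual code `C^⊥` of a linear code `C ⊆ F^N` for the standard Euclidean inner product. -/
def dualCode {F : Type*} [Field F] {N : ℕ} (C : Submodule F (Fin N → F)) :
    Submodule F (Fin N → F) where
  carrier := {u | ∀ v ∈ C, u ⬝ᵥ v = 0}
  zero_mem' := fun v _ => zero_dotProduct v
  add_mem' := fun {a b} ha hb v hv => by
    rw [add_dotProduct, ha v hv, hb v hv, add_zero]
  smul_mem' := fun c a ha v hv => by
    rw [smul_dotProduct, ha v hv, smul_zero]

/-- The `lam`-constacyclic shift
`(c_0, c_1, …, c_{N-1}) ↦ (lam * c_{N-1}, c_0, …, c_{N-2})`. -/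
def constacyclicShift {F : Type*} [Field F] {N : ℕ} (lam : F) (c : Fin N → F) : Fin N → F :=
  fun i => if i.val = 0 then lam * c ⟨N - 1, by have := i.isLt; omega⟩
    else c ⟨i.val - 1, by have := i.isLt; omega⟩

/-- `C` is a `lam`-constacyclic code of length `N` over `F`. -/
def IsConstacyclic {F : Type*} [Field F] {N : ℕ} (lam : F) (C : Submodule F (Fin N → F)) : Prop :=
  ∀ c ∈ C, constacyclicShift lam c ∈ C

/-- The polynomial `c_0 + c_1 X + ⋯ + c_{N-1} X^{N-1}` of a word `c`. -/
noncomputable def wordPoly {F : Type*} [Field F] {N : ℕ} (c : Fin N → F) : F[X] :=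
  ∑ i : Fin N, C (c i) * X ^ (i : ℕ)

/-- `D = ⟨g⟩` as a `lam`-constacyclic code: `g` is a monic divisor of `X^N - lam`, and the words
of `D` are those whose polynomials have their classes in the ideal of `F[X] / (X^N - lam)`
generated by the class of `g`. -/
def IsGeneratorPoly {F : Type*} [Field F] {N : ℕ} (lam : F) (D : Submodule F (Fin N → F))
    (g : F[X]) : Prop :=
  g.Monic ∧ g ∣ X ^ N - C lam ∧
    ∀ c : Fin N → F, c ∈ D ↔
      Ideal.Quotient.mk (Ideal.span {(X ^ N - C lam : F[X])}) (wordPoly c) ∈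
        Ideal.span {Ideal.Quotient.mk (Ideal.span {(X ^ N - C lam : F[X])}) g}

/-- `D = ⟨g⟩` for a polynomial `g` written down over an extension field `K` of `F`: `g` has its
coefficients in `F`, and it is the generator polynomial of the `lam`-constacyclic code `D`. -/
def IsGeneratorPolyOver {F K : Type*} [Field F] [Field K] [Algebra F K] {N : ℕ} (lam : F)
    (D : Submodule F (Fin N → F)) (g : K[X]) : Prop :=
  ∃ g₀ : F[X], g₀.map (algebraMap F K) = g ∧ IsGeneratorPoly lam D g₀

/-- `hatScale f a` is the monic polynomial `\hat f(aX)` proportional to `f(aX)`. -/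
noncomputable def hatScale {K : Type*} [Field K] (f : K[X]) (a : K) : K[X] :=
  C (f.comp (C a * X)).leadingCoeff⁻¹ * f.comp (C a * X)

open Classical in
/-- The `Q`-cyclotomic coset of `t` modulo `k`, i.e. `{t, tQ, tQ^2, …}`. -/
noncomputable def cyclotomicCoset (Q : ℕ) {k : ℕ} [NeZero k] (t : ZMod k) : Finset (ZMod k) :=
  Finset.univ.filter fun x => ∃ j : ℕ, x = t * (Q : ZMod k) ^ j

/-- `M_t(X)`: the minimal polynomial of `η^t` over `F`. -/
noncomputable def polyM (F : Type*) {K : Type*} [Field F] [Field K] [Algebra F K] {k : ℕ}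
    (η : K) (t : ZMod k) : F[X] :=
  minpoly F (η ^ t.val)

/-- `N_t(X) = ∏ (X - η^s)`, where `s` runs over the `q^2`-cyclotomic coset of `t` modulo `k`. -/
noncomputable def polyN {K : Type*} [Field K] (q : ℕ) {k : ℕ} [NeZero k]
    (η : K) (t : ZMod k) : K[X] :=
  ∏ s ∈ cyclotomicCoset (q ^ 2) t, (X - C (η ^ s.val))

/-- `\hat M_t(βX) \hat M_t(-βX)`. -/
noncomputable def polyS (F : Type*) {K : Type*} [Field F] [Field K] [Algebra F K] {k : ℕ}
    (η β : K) (t : ZMod k) : K[X] :=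
  hatScale ((polyM F η t).map (algebraMap F K)) β *
    hatScale ((polyM F η t).map (algebraMap F K)) (-β)

/-- `\hat N_t(βX) \hat N_{tq}(-βX)`. -/
noncomputable def polyQ {K : Type*} [Field K] (q : ℕ) {k : ℕ} [NeZero k]
    (η β : K) (t : ZMod k) : K[X] :=
  hatScale (polyN q η t) β * hatScale (polyN q η (t * (q : ZMod k))) (-β)

/-- `\hat N_{tq}(βX) \hat N_t(-βX)`. -/
noncomputable def polyR {K : Type*} [Field K] (q : ℕ) {k : ℕ} [NeZero k]
    (η β : K) (t : ZMod k) : K[X] :=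
  hatScale (polyN q η (t * (q : ZMod k))) β * hatScale (polyN q η t) (-β)

/-! A constacyclic code is an ideal of `F[X] / (X ^ N - lam)`, hence is generated by a monic divisor
`g` of `X ^ N - lam`. If `g * h = X ^ N - lam`, the dual code is generated by the monic reciprocal
of `h` (`IsGeneratorPoly.dualCode`). So everything rests on factoring `X ^ N - lam` over `F`. Put k
= ℓ^m and choose γ in K with γ^N · lam = 1: γ = a in case (A), γ = β₁b in case (B). In
characteristic p, `X ^ N - lam` is the p^n-th power of X^(2k) - γ^(-2k), whose roots are the
distinct elements ±η^s/γ with s in ℤ/k. The irreducible factors over `F` are the products over the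
orbits of x ↦ x^q (`map_minpoly_eq_of_isRoot_iff`, `isGeneratorPolyOver_of_orbits`). In case (A),
γ^q = γ, so the sign is kept and the orbits are the signed q-cyclotomic cosets. In case (B), γ^q =
-γ, so Frobenius sends η^s/γ to -η^(sq)/γ. If f is odd, q has odd order modulo k, and each orbit
contains a full coset with both signs; this is S_i. If f is even, a nonzero coset splits into two
q²-cosets, and the orbits pair one half with sign + and the other with sign -; these are Q_i and
R_i. Inverting roots replaces γ by γ⁻¹ and s by -s, which gives the duals. -/

/-! ### Constacyclic codes as ideals, and their duals. -/

section CodeTheory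

variable {F : Type*} [Field F] {N : ℕ}

theorem wordPoly_coeff (c : Fin N → F) (i : Fin N) : (wordPoly c).coeff i = c i := by
  classical
  simp only [wordPoly, finsetSum_coeff, coeff_C_mul, coeff_X_pow]
  rw [Finset.sum_eq_single i]
  · simp
  · intro j _ hj
    simp [Fin.val_inj, hj.symm]
  · simp

theorem wordPoly_degree_lt (c : Fin N → F) : (wordPoly c).degree < N := by
  rw [wordPoly, degree_lt_iff_coeff_zero]
  intro k hk
  simp only [finsetSum_coeff, coeff_C_mul, coeff_X_pow]
  refine Finset.sum_eq_zero fun i _ => ?_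
  rw [if_neg (by have := i.isLt; omega), mul_zero]

theorem wordPoly_coeff_eq (f : F[X]) (hf : f.degree < N) :
    wordPoly (fun i : Fin N => f.coeff i) = f := by
  ext k
  rcases lt_or_ge k N with hk | hk
  · exact wordPoly_coeff (fun i : Fin N => f.coeff i) ⟨k, hk⟩
  · rw [(degree_lt_iff_coeff_zero _ _).1 (wordPoly_degree_lt _) k hk,
      (degree_lt_iff_coeff_zero _ _).1 hf k hk]

/-- The coefficient pushed up to degree `N` returns, multiplied by `lam`, as the constant term:
modulo `X ^ N - lam` the shift is multiplication by `X`. -/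
theorem X_mul_wordPoly (lam : F) (c : Fin N → F) (hN : 0 < N) :
    X * wordPoly c = wordPoly (constacyclicShift lam c) +
      C (c ⟨N - 1, by omega⟩) * (X ^ N - C lam) := by
  ext k
  have hz : ∀ (d : Fin N → F) (j : ℕ), N ≤ j → (wordPoly d).coeff j = 0 := fun d j hj =>
    (degree_lt_iff_coeff_zero _ _).1 (wordPoly_degree_lt d) j hj
  rw [coeff_add, coeff_C_mul, coeff_sub, coeff_X_pow]
  rcases k with _ | k
  · have h0 := wordPoly_coeff (constacyclicShift lam c) ⟨0, hN⟩
    simp only at h0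
    rw [h0, coeff_X_mul_zero, if_neg (by omega), coeff_C_zero]
    simp [constacyclicShift]
    ring
  · rw [coeff_X_mul, coeff_C_succ]
    rcases lt_trichotomy (k + 1) N with hk | hk | hk
    · have h1 := wordPoly_coeff (constacyclicShift lam c) ⟨k + 1, hk⟩
      have h2 := wordPoly_coeff c ⟨k, by omega⟩
      simp only at h1 h2
      rw [h1, h2, if_neg (by omega)]
      simp [constacyclicShift]
    · have h2 := wordPoly_coeff c ⟨k, by omega⟩
      simp only at h2
      rw [h2, hz _ _ hk.ge, if_pos hk]
      have : (⟨N - 1, by omega⟩ : Fin N) = ⟨k, by omega⟩ := by ext; simp; omega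
      rw [this]; ring
    · rw [hz _ _ (by omega), hz _ _ (by omega), if_neg (by omega)]; ring

theorem mem_span_mk_iff_dvd {M g w : F[X]} (hg : g ∣ M) :
    Ideal.Quotient.mk (Ideal.span {M}) w ∈ Ideal.span {Ideal.Quotient.mk (Ideal.span {M}) g} ↔
      g ∣ w := by
  rw [Ideal.mem_span_singleton]
  constructor
  · rintro ⟨u, hu⟩
    obtain ⟨u, rfl⟩ := Ideal.Quotient.mk_surjective u
    rw [← map_mul, Ideal.Quotient.eq, Ideal.mem_span_singleton] at hu
    have := (hg.trans hu).add (dvd_mul_right g u)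
    simpa using this
  · exact fun h => map_dvd _ h

theorem isGeneratorPoly_iff (lam : F) (D : Submodule F (Fin N → F)) (g : F[X]) :
    IsGeneratorPoly lam D g ↔ g.Monic ∧ g ∣ X ^ N - C lam ∧
      ∀ c : Fin N → F, c ∈ D ↔ g ∣ wordPoly c := by
  unfold IsGeneratorPoly
  refine and_congr_right fun _ => and_congr_right fun h => ?_
  simp only [mem_span_mk_iff_dvd h]

theorem IsGeneratorPoly.isConstacyclic {lam : F} {D : Submodule F (Fin N → F)} {g : F[X]}
    (hN : 0 < N) (h : IsGeneratorPoly lam D g) : IsConstacyclic lam D := by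
  rw [isGeneratorPoly_iff] at h
  intro c hc
  rw [h.2.2] at hc ⊢
  have := X_mul_wordPoly lam c hN
  rw [← sub_eq_iff_eq_add] at this
  rw [← this]
  exact dvd_sub (hc.mul_left _) (h.2.1.mul_left _)

/-- The word of length `N` congruent to `f` modulo `X ^ N - lam`. -/
noncomputable def reducedWord (N : ℕ) (lam : F) : F[X] →ₗ[F] (Fin N → F) :=
  LinearMap.pi fun i => (lcoeff F i).comp (modByMonicHom (X ^ N - C lam))

theorem wordPoly_reducedWord (lam : F) (hN : 0 < N) (f : F[X]) :
    wordPoly (reducedWord N lam f) = f %ₘ (X ^ N - C lam) := by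
  refine wordPoly_coeff_eq (N := N) (f %ₘ (X ^ N - C lam)) ?_
  have := degree_modByMonic_lt f (monic_X_pow_sub_C lam hN.ne')
  rwa [degree_X_pow_sub_C hN] at this

theorem wordPoly_injective : Function.Injective (wordPoly : (Fin N → F) → F[X]) := by
  intro c d h
  ext i
  rw [← wordPoly_coeff c, h, wordPoly_coeff]

theorem reducedWord_eq_of_dvd (lam : F) (hN : 0 < N) {f g : F[X]} (h : X ^ N - C lam ∣ f - g) :
    reducedWord N lam f = reducedWord N lam g := by
  apply wordPoly_injective
  rw [wordPoly_reducedWord _ hN, wordPoly_reducedWord _ hN,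
    modByMonic_eq_of_dvd_sub (monic_X_pow_sub_C lam hN.ne') h]

theorem reducedWord_wordPoly (lam : F) (hN : 0 < N) (c : Fin N → F) :
    reducedWord N lam (wordPoly c) = c := by
  apply wordPoly_injective
  rw [wordPoly_reducedWord _ hN, modByMonic_eq_self_iff (monic_X_pow_sub_C lam hN.ne'),
    degree_X_pow_sub_C hN]
  exact wordPoly_degree_lt c

theorem reducedWord_X_mul (lam : F) (hN : 0 < N) (f : F[X]) :
    reducedWord N lam (X * f) = constacyclicShift lam (reducedWord N lam f) := by
  rw [← reducedWord_wordPoly lam hN (constacyclicShift lam (reducedWord N lam f))]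
  apply reducedWord_eq_of_dvd lam hN
  have h1 := X_mul_wordPoly lam (reducedWord N lam f) hN
  rw [← sub_eq_iff_eq_add] at h1
  rw [← h1, wordPoly_reducedWord _ hN]
  have h2 := modByMonic_add_div f (X ^ N - C lam)
  refine ⟨X * (f /ₘ (X ^ N - C lam)) + C ((reducedWord N lam f) ⟨N - 1, by omega⟩), ?_⟩
  linear_combination (-X) * h2

/-- The polynomials whose reduced words lie in `D` form an ideal of the principal ideal domain
`F[X]`. It contains `X ^ N - lam`, which reduces to 0, so its generator is a nonzero divisor of that
polynomial. -/
theorem IsConstacyclic.exists_isGeneratorPoly {lam : F} {D : Submodule F (Fin N → F)}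
    (hN : 0 < N) (h : IsConstacyclic lam D) : ∃ g, IsGeneratorPoly lam D g := by
  have hX : ∀ f, reducedWord N lam f ∈ D → reducedWord N lam (X * f) ∈ D := fun f hf => by
    rw [reducedWord_X_mul lam hN]; exact h _ hf
  let J : Ideal F[X] :=
    { carrier := {f | reducedWord N lam f ∈ D}
      zero_mem' := by simp
      add_mem' := fun {a b} ha hb => by
        simp only [Set.mem_ofPred_eq, map_add] at *
        exact D.add_mem ha hb
      smul_mem' := fun c x hx => by
        simp only [Set.mem_ofPred_eq, smul_eq_mul] at *
        induction c using Polynomial.induction_on' with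
        | add p q hp hq => rw [add_mul, map_add]; exact D.add_mem hp hq
        | monomial k a =>
          rw [← C_mul_X_pow_eq_monomial, mul_assoc, ← smul_eq_C_mul, map_smul]
          apply D.smul_mem
          induction k with
          | zero => simpa using hx
          | succ k ih => rw [pow_succ', mul_assoc]; exact hX _ ih }
  have hJ : ∀ f, f ∈ J ↔ reducedWord N lam f ∈ D := fun f => Iff.rfl
  have hM : X ^ N - C lam ∈ J := by
    rw [hJ, reducedWord_eq_of_dvd lam hN (g := 0) (by simp), map_zero]
    exact D.zero_mem
  obtain ⟨g, hg⟩ := (IsPrincipalIdealRing.principal J).principal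
  have hg' : ∀ f, f ∈ J ↔ g ∣ f := fun f => by
    rw [hg]; exact Ideal.mem_span_singleton
  have hM0 := (monic_X_pow_sub_C lam hN.ne').ne_zero
  have hg0 : g ≠ 0 := by
    rintro rfl
    exact hM0 (zero_dvd_iff.1 ((hg' _).1 hM))
  have hu : Associated (g * C g.leadingCoeff⁻¹) g :=
    associated_mul_unit_left _ _ (isUnit_C.2 (isUnit_iff_ne_zero.2 (by simpa using hg0)))
  refine ⟨g * C g.leadingCoeff⁻¹, (isGeneratorPoly_iff _ _ _).2 ⟨monic_mul_leadingCoeff_inv hg0,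
    hu.dvd_iff_dvd_left.2 ((hg' _).1 hM), fun c => ?_⟩⟩
  rw [hu.dvd_iff_dvd_left, ← hg', hJ, reducedWord_wordPoly lam hN]

/-- The monic polynomial proportional to the reciprocal polynomial of `f`. -/
noncomputable def monicReverse (f : F[X]) : F[X] :=
  C (f.coeff 0)⁻¹ * f.reverse

/-- No condition on constant terms is needed: if one of them is 0, the convention `0⁻¹ = 0` makes
both sides vanish. -/
theorem monicReverse_mul (f g : F[X]) : monicReverse (f * g) = monicReverse f * monicReverse g := by
  simp only [monicReverse, reverse_mul_of_domain, mul_coeff_zero, mul_inv, C_mul]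
  ring

theorem monicReverse_one : monicReverse (1 : F[X]) = 1 := by
  have h : (1 : F[X]).reverse = 1 := reverse_C 1
  simp [monicReverse, h]

/-- `monicReverse` as a monoid homomorphism. -/
noncomputable def monicReverseHom : F[X] →* F[X] where
  toFun := monicReverse
  map_one' := monicReverse_one
  map_mul' := monicReverse_mul

theorem monicReverse_map {K : Type*} [Field K] (φ : F →+* K) (f : F[X]) :
    (monicReverse f).map φ = monicReverse (f.map φ) := by
  simp [monicReverse, reverse, natDegree_map, reflect_map]

theorem monic_monicReverse {f : F[X]} (hf : f.coeff 0 ≠ 0) : (monicReverse f).Monic := by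
  rw [monicReverse, Monic, leadingCoeff_mul, leadingCoeff_C, reverse_leadingCoeff,
    trailingCoeff_eq_coeff_zero hf, inv_mul_cancel₀ hf]

theorem monicReverse_X_pow_sub_C {lam : F} (hlam : lam ≠ 0) (hN : 0 < N) :
    monicReverse (X ^ N - C lam) = X ^ N - C lam⁻¹ := by
  have h0 : (X ^ N - C lam : F[X]).coeff 0 = -lam := by
    simp [coeff_X_pow, hN.ne]
  rw [monicReverse, reverse, natDegree_X_pow_sub_C, reflect_sub, reflect_monomial, reflect_C,
    revAt_le le_rfl, h0, mul_sub, ← mul_assoc, ← C_mul]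
  simp [hlam]
  ring

theorem reflect_dvd_of_dvd_reverse {h w : F[X]} (h0 : h.coeff 0 ≠ 0) {n : ℕ}
    (hw : w.natDegree ≤ n) (hd : h ∣ w) : h.reverse ∣ reflect n w := by
  obtain ⟨b, rfl⟩ := hd
  rcases eq_or_ne b 0 with rfl | hb
  · simp
  have hh : h ≠ 0 := by rintro rfl; simp at h0
  rw [natDegree_mul hh hb] at hw
  obtain ⟨r, rfl⟩ := Nat.exists_eq_add_of_le (show h.natDegree ≤ n by omega)
  rw [reflect_mul h b le_rfl (by omega)]
  exact dvd_mul_right _ _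

/-- Reflection is an involution compatible with products. Since `h` has nonzero constant term,
reversing it twice gives `h` back, so one implication yields the other. -/
theorem dvd_reflect_iff {h w : F[X]} (h0 : h.coeff 0 ≠ 0) {n : ℕ} (hw : w.natDegree ≤ n) :
    h ∣ reflect n w ↔ h.reverse ∣ w := by
  have hw' : (reflect n w).natDegree ≤ n := natDegree_reflect_le.trans (max_le le_rfl hw)
  constructor
  · intro hd
    have := reflect_dvd_of_dvd_reverse h0 hw' hd
    rwa [reflect_reflect] at this
  · intro hd
    have hh : h ≠ 0 := by rintro rfl; simp at h0
    have hdeg : h.reverse.natDegree = h.natDegree := by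
      rw [reverse_natDegree, natTrailingDegree_eq_zero.2 (Or.inr h0), Nat.sub_zero]
    have hrr : h.reverse.reverse = h := by
      rw [reverse, hdeg, reverse, reflect_reflect]
    have := reflect_dvd_of_dvd_reverse (h := h.reverse) (by simpa using hh) hw hd
    rwa [hrr] at this

/-- Reversing one word turns the inner product into a convolution, and so orthogonality into a
condition on a polynomial product. -/
theorem coeff_mul_reflect_wordPoly (hN : 0 < N) (u v : Fin N → F) :
    (wordPoly v * reflect (N - 1) (wordPoly u)).coeff (N - 1) = u ⬝ᵥ v := by
  rw [coeff_mul, Finset.Nat.sum_antidiagonal_eq_sum_range_succ_mk, Nat.succ_eq_add_one,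
    Nat.sub_add_cancel hN, Finset.sum_range, dotProduct]
  refine Finset.sum_congr rfl fun i _ => ?_
  simp only
  rw [coeff_reflect, revAt_le (Nat.sub_le _ _), wordPoly_coeff,
    Nat.sub_sub_self (by have := i.isLt; omega), wordPoly_coeff, mul_comm]

theorem wordPoly_natDegree_le (c : Fin N → F) (hN : 0 < N) : (wordPoly c).natDegree ≤ N - 1 := by
  rw [natDegree_le_iff_degree_le]
  refine degree_le_iff_coeff_zero _ _ |>.2 fun k hk => ?_
  refine (degree_lt_iff_coeff_zero _ _).1 (wordPoly_degree_lt c) k ?_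
  have : N - 1 < k := by exact_mod_cast hk
  omega

/-- When the quotient is nonzero it has degree at most `N - 2`, so its product with `X ^ N - lam`
has no term in degree `N - 1`. -/
theorem coeff_modByMonic_X_pow_sub_C (lam : F) (hN : 0 < N) {f : F[X]}
    (hf : f.natDegree ≤ 2 * (N - 1)) :
    (f %ₘ (X ^ N - C lam)).coeff (N - 1) = f.coeff (N - 1) := by
  have hM := monic_X_pow_sub_C lam hN.ne'
  rcases lt_or_ge f.natDegree N with hlt | hge
  · rw [(modByMonic_eq_self_iff hM).2]
    rw [degree_X_pow_sub_C hN]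
    exact degree_le_natDegree.trans_lt (by exact_mod_cast hlt)
  conv_rhs => rw [← modByMonic_add_div f (X ^ N - C lam)]
  rw [coeff_add, sub_mul, coeff_sub, coeff_X_pow_mul', coeff_C_mul, if_neg (by omega),
   
    coeff_eq_zero_of_natDegree_lt (p := f /ₘ (X ^ N - C lam))]
  · simp
  · rw [natDegree_divByMonic _ hM, natDegree_X_pow_sub_C]
    omega

/-- Nondegeneracy of a bilinear form on the quotient ring: a suitable power of `X` moves the leading
coefficient of a nonzero remainder to degree `N - 1` without wrapping around. -/
theorem dvd_iff_forall_coeff_modByMonic (lam : F) (hN : 0 < N) (f : F[X]) :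
    X ^ N - C lam ∣ f ↔ ∀ a, ((f * a) %ₘ (X ^ N - C lam)).coeff (N - 1) = 0 := by
  have hM := monic_X_pow_sub_C lam hN.ne'
  constructor
  · intro h a
    rw [(modByMonic_eq_zero_iff_dvd hM).2 (h.mul_right a), coeff_zero]
  · intro h
    rw [← modByMonic_eq_zero_iff_dvd hM]
    by_contra hr
    set r := f %ₘ (X ^ N - C lam) with hrdef
    have hdeg : r.natDegree < N := by
      have := natDegree_modByMonic_lt f hM (by
        intro h1
        have := congrArg natDegree h1
        rw [natDegree_X_pow_sub_C, natDegree_one] at this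
        omega)
      rwa [natDegree_X_pow_sub_C] at this
    have h1 := h (X ^ (N - 1 - r.natDegree))
    have h2 : (f * X ^ (N - 1 - r.natDegree)) %ₘ (X ^ N - C lam) =
        r * X ^ (N - 1 - r.natDegree) := by
      rw [modByMonic_eq_of_dvd_sub hM (p₂ := r * X ^ (N - 1 - r.natDegree)),
        modByMonic_eq_self_iff hM, degree_X_pow_sub_C hN]
      · rw [degree_eq_natDegree (mul_ne_zero hr (pow_ne_zero _ X_ne_zero)),
          natDegree_mul_X_pow _ hr]
        exact_mod_cast (by omega)
      · rw [← sub_mul]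
        refine Dvd.dvd.mul_right ?_ _
        rw [hrdef]
        exact ⟨f /ₘ (X ^ N - C lam), by
          linear_combination -(modByMonic_add_div f (X ^ N - C lam))⟩
    rw [h2, coeff_mul_X_pow', if_pos (by omega)] at h1
    rw [show N - 1 - (N - 1 - r.natDegree) = r.natDegree by omega] at h1
    exact hr (leadingCoeff_eq_zero.1 h1)

/-- With `U` the reflected polynomial of `u`, orthogonality to all multiples of `g` says that `g *
h` divides `g * U`. Cancelling `g` leaves `h ∣ U`, and reflecting back gives the claim. -/
theorem mem_dualCode_iff {lam : F} {D : Submodule F (Fin N → F)} {g h : F[X]}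
    (hN : 0 < N) (hlam : lam ≠ 0) (hD : IsGeneratorPoly lam D g) (hgh : g * h = X ^ N - C lam)
    (u : Fin N → F) : u ∈ dualCode D ↔ monicReverse h ∣ wordPoly u := by
  rw [isGeneratorPoly_iff] at hD
  have hM := monic_X_pow_sub_C lam hN.ne'
  have h0 : (g * h).coeff 0 ≠ 0 := by
    rw [hgh]; simp [coeff_X_pow, hN.ne, hlam]
  rw [mul_coeff_zero] at h0
  have hh0 := right_ne_zero_of_mul h0
  have hg0 : g ≠ 0 := hD.1.ne_zero
  have hu : (wordPoly u).natDegree ≤ N - 1 := wordPoly_natDegree_le u hN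
  have hU : (reflect (N - 1) (wordPoly u)).natDegree ≤ N - 1 :=
    natDegree_reflect_le.trans (max_le le_rfl hu)
  have e1 : monicReverse h ∣ wordPoly u ↔ h.reverse ∣ wordPoly u := by
    rw [monicReverse, mul_comm]
    exact (associated_mul_unit_left _ _ (isUnit_C.2 (isUnit_iff_ne_zero.2
      (inv_ne_zero hh0)))).dvd_iff_dvd_left
  rw [e1, ← dvd_reflect_iff hh0 hu, ← mul_dvd_mul_iff_left hg0, hgh,
    dvd_iff_forall_coeff_modByMonic lam hN]
  have key : ∀ v : Fin N → F,
      ((wordPoly v * reflect (N - 1) (wordPoly u)) %ₘ (X ^ N - C lam)).coeff (N - 1) = u ⬝ᵥ v := by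
    intro v
    rw [coeff_modByMonic_X_pow_sub_C lam hN, coeff_mul_reflect_wordPoly hN]
    exact natDegree_mul_le.trans (by have := wordPoly_natDegree_le v hN; omega)
  constructor
  · intro hu a
    have hv : reducedWord N lam (g * a) ∈ D := by
      rw [hD.2.2, wordPoly_reducedWord lam hN, ← dvd_sub_right (dvd_mul_right g a)]
      refine hD.2.1.trans ⟨(g * a) /ₘ (X ^ N - C lam), ?_⟩
      linear_combination -(modByMonic_add_div (g * a) (X ^ N - C lam))
    rw [← hu _ hv, ← key, wordPoly_reducedWord lam hN]
    congr 1
    apply modByMonic_eq_of_dvd_sub hM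
    refine ⟨(g * a) /ₘ (X ^ N - C lam) * reflect (N - 1) (wordPoly u), ?_⟩
    linear_combination
      -(reflect (N - 1) (wordPoly u)) * (modByMonic_add_div (g * a) (X ^ N - C lam))
  · intro H v hv
    obtain ⟨a, ha⟩ := (hD.2.2 v).1 hv
    rw [← key, ha, mul_right_comm]
    exact H a

theorem IsGeneratorPoly.dualCode {lam : F} {D : Submodule F (Fin N → F)} {g h : F[X]}
    (hN : 0 < N) (hlam : lam ≠ 0) (hD : IsGeneratorPoly lam D g) (hgh : g * h = X ^ N - C lam) :
    IsGeneratorPoly lam⁻¹ (dualCode D) (monicReverse h) := by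
  rw [isGeneratorPoly_iff]
  refine ⟨monic_monicReverse ?_, ?_, mem_dualCode_iff hN hlam hD hgh⟩
  · have h0 : (g * h).coeff 0 ≠ 0 := by
      rw [hgh]; simp [coeff_X_pow, hN.ne, hlam]
    rw [mul_coeff_zero] at h0
    exact right_ne_zero_of_mul h0
  · rw [← monicReverse_X_pow_sub_C hlam hN, ← hgh, monicReverse_mul]
    exact dvd_mul_left _ _

end CodeTheory

/-! ### Irreducible factors as Frobenius orbits. -/

section FrobeniusOrbits

variable {F K : Type*} [Field F] [Fintype F] [Field K] [Algebra F K]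

/-- X^q - X already splits over `F`, so it has no further roots in `K`. -/
theorem mem_range_algebraMap_of_pow_card_eq {x : K} (hx : x ^ Fintype.card F = x) :
    x ∈ Set.range (algebraMap F K) := by
  have hq : 1 < Fintype.card F := Fintype.one_lt_card
  have h0 := FiniteField.X_pow_card_sub_X_ne_zero F hq
  have hs : (X ^ Fintype.card F - X : F[X]).Splits := by
    rw [splits_iff_card_roots, FiniteField.roots_X_pow_card_sub_X,
      FiniteField.X_pow_card_sub_X_natDegree_eq F hq]
    rfl
  exact hs.mem_range_of_isRoot h0 (i := algebraMap F K) (by simp [hx])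

theorem aeval_pow_card (f : F[X]) (x : K) :
    aeval (x ^ Fintype.card F) f = aeval x f ^ Fintype.card F := by
  rw [← expand_aeval, FiniteField.expand_card, map_pow]

theorem aeval_pow_card_pow (f : F[X]) (x : K) (j : ℕ) :
    aeval (x ^ Fintype.card F ^ j) f = aeval x f ^ Fintype.card F ^ j := by
  induction j with
  | zero => simp
  | succ j ih => rw [pow_succ, pow_mul, aeval_pow_card, ih, ← pow_mul]

/-- Frobenius permutes the roots of `G`, hence fixes its coefficients, so `G` comes from `F[X]` and
is divisible by the minimal polynomial. Conversely every q^j-th power of `r` is a root of that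
minimal polynomial. -/
theorem map_minpoly_eq_of_isRoot_iff {G : K[X]} (hm : G.Monic) (hs : G.Splits) (hsep : G.Separable)
    {r : K} (hr : ∀ x, G.IsRoot x ↔ ∃ j : ℕ, x = r ^ Fintype.card F ^ j) (hint : IsIntegral F r) :
    (minpoly F r).map (algebraMap F K) = G := by
  classical
  obtain ⟨p, hp⟩ := CharP.exists F
  have : Fact p.Prime := ⟨CharP.char_is_prime F p⟩
  have : CharP K p := charP_of_injective_algebraMap (algebraMap F K).injective p
  obtain ⟨k, -, hk⟩ := FiniteField.card F p
  have hG0 := hm.ne_zero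
  set φ := iterateFrobenius K p k with hφdef
  have hφ : ∀ x, φ x = x ^ Fintype.card F := fun x => by rw [hk, hφdef, iterateFrobenius_def]
  have hroots : G.roots.map φ = G.roots := by
    have hnd := nodup_roots hsep
    -- An injective map of a finite set into itself is onto, so stability under Frobenius suffices.
    refine Multiset.eq_of_le_of_card_le ((Multiset.le_iff_subset (hnd.map φ.injective)).2 ?_)
      (Multiset.card_map _ _).ge
    intro y hy
    obtain ⟨x, hx, rfl⟩ := Multiset.mem_map.1 hy
    rw [mem_roots hG0, hr] at hx ⊢
    obtain ⟨j, rfl⟩ := hx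
    exact ⟨j + 1, by rw [hφ, ← pow_mul, pow_succ]⟩
  have hfix : G.map φ = G := by
    have h1 := hs.eq_prod_roots_of_monic hm
    conv_lhs => rw [h1]
    conv_rhs => rw [h1, ← hroots]
    simp [Polynomial.map_multiset_prod, Multiset.map_map]
  obtain ⟨g, hg⟩ : ∃ g : F[X], g.map (algebraMap F K) = G := by
    rw [← mem_lifts, lifts_iff_coeff_lifts]
    intro i
    apply mem_range_algebraMap_of_pow_card_eq
    rw [← hφ, ← coeff_map, hfix]
  have hmin := minpoly.monic hint
  apply eq_of_monic_of_associated (hmin.map _) hm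
  apply associated_of_dvd_dvd
  · rw [← hg]
    refine Polynomial.map_dvd (algebraMap F K) (minpoly.dvd F r ?_)
    rw [aeval_def, ← eval_map, hg]
    exact (hr r).2 ⟨0, by simp⟩
  · refine hs.dvd_of_roots_le_roots hG0 ((Multiset.le_iff_subset (nodup_roots hsep)).2 ?_)
    intro x hx
    rw [mem_roots hG0, hr] at hx
    obtain ⟨j, rfl⟩ := hx
    rw [mem_roots (hmin.map _).ne_zero, IsRoot, eval_map, ← aeval_def, aeval_pow_card_pow,
      minpoly.aeval, zero_pow (by positivity)]

theorem exists_prod_pow_of_dvd {R ι : Type*} [CommRing R] [IsDomain R] [DecompositionMonoid R]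
    (s : Finset ι) (f : ι → R)
    (hf : ∀ i ∈ s, Prime (f i)) (k : ℕ) {g : R} (hg : g ∣ ∏ i ∈ s, f i ^ k) :
    ∃ ε : ι → ℕ, (∀ i, ε i ≤ k) ∧ Associated g (∏ i ∈ s, f i ^ ε i) := by
  classical
  induction s using Finset.induction_on generalizing g with
  | empty => exact ⟨fun _ => 0, fun _ => Nat.zero_le _, by simpa [isUnit_iff_dvd_one] using hg⟩
  | insert a s ha ih =>
    rw [Finset.prod_insert ha] at hg
    obtain ⟨g₁, g₂, h₁, h₂, rfl⟩ := exists_dvd_and_dvd_of_dvd_mul hg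
    obtain ⟨j, hj, hj'⟩ := (dvd_prime_pow (hf a (by simp)) k).1 h₁
    obtain ⟨ε, hε, hε'⟩ := ih (fun i hi => hf i (by simp [hi])) h₂
    refine ⟨Function.update ε a j, fun i => ?_, ?_⟩
    · rcases eq_or_ne i a with rfl | h
      · simpa using hj
      · simpa [h] using hε i
    · rw [Finset.prod_insert ha, Function.update_self]
      refine hj'.mul_mul ?_
      rwa [Finset.prod_congr rfl fun i hi => ?_]
      rw [Function.update_of_ne (by rintro rfl; exact ha hi)]

/-- The generator polynomials of the constacyclic codes of length `N` and of their duals, from a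
factorization of `X ^ N - lam` into powers of polynomials whose roots are Frobenius orbits. -/
theorem isGeneratorPolyOver_of_orbits {ι : Type*} [Fintype ι] {N k : ℕ} (hN : 0 < N) (hk : k ≠ 0)
    {lam : F} (hlam : lam ≠ 0)
    (G : ι → K[X]) (hm : ∀ i, (G i).Monic) (hs : ∀ i, (G i).Splits) (hsep : (∏ i, G i).Separable)
    (horb : ∀ i, ∃ r, ∀ x, (G i).IsRoot x ↔ ∃ j : ℕ, x = r ^ Fintype.card F ^ j)
    (hprod : (∏ i, G i) ^ k = X ^ N - C (algebraMap F K lam))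
    (D : Submodule F (Fin N → F)) (hD : IsConstacyclic lam D) :
    (∃ ε : ι → ℕ, (∀ i, ε i ≤ k) ∧ IsGeneratorPolyOver lam D (∏ i, G i ^ ε i)) ∧
    ∀ ε : ι → ℕ, (∀ i, ε i ≤ k) → IsGeneratorPolyOver lam D (∏ i, G i ^ ε i) →
      IsConstacyclic lam⁻¹ (dualCode D) ∧
      IsGeneratorPolyOver lam⁻¹ (dualCode D) (∏ i, monicReverse (G i) ^ (k - ε i)) := by
  choose r hr using horb
  have hint : ∀ i, IsIntegral F (r i) := fun i => by
    have h1 : (G i).IsRoot (r i) := (hr i _).2 ⟨0, by simp⟩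
    have h2 : (X ^ N - C (algebraMap F K lam)).IsRoot (r i) := by
      rw [← hprod]
      exact h1.dvd ((Finset.dvd_prod_of_mem G (Finset.mem_univ i)).trans (dvd_pow_self _ hk))
    have h3 : r i ^ N = algebraMap F K lam := by
      simpa [IsRoot, sub_eq_zero] using h2
    exact IsIntegral.of_pow hN (h3 ▸ isIntegral_algebraMap)
  have hmin : ∀ i, (minpoly F (r i)).map (algebraMap F K) = G i := fun i =>
    map_minpoly_eq_of_isRoot_iff (hm i) (hs i)
      (hsep.of_dvd (Finset.dvd_prod_of_mem G (Finset.mem_univ i))) (hr i) (hint i)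
  have hinj : Function.Injective (Polynomial.map (algebraMap F K)) :=
    map_injective _ (algebraMap F K).injective
  have hprodF : ∏ i, minpoly F (r i) ^ k = X ^ N - C lam := by
    apply hinj
    rw [Polynomial.map_prod]
    simp only [Polynomial.map_pow, hmin, Finset.prod_pow, hprod]
    simp
  have hmapF : ∀ ε : ι → ℕ,
      (∏ i, minpoly F (r i) ^ ε i).map (algebraMap F K) = ∏ i, G i ^ ε i := fun ε => by
    rw [Polynomial.map_prod]
    simp only [Polynomial.map_pow, hmin]
  constructor
  · obtain ⟨g, hg⟩ := hD.exists_isGeneratorPoly hN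
    obtain ⟨ε, hε, ha⟩ := exists_prod_pow_of_dvd Finset.univ (fun i => minpoly F (r i))
      (fun i _ => minpoly.prime (hint i)) k (hprodF ▸ hg.2.1)
    refine ⟨ε, hε, g, ?_, hg⟩
    rw [← hmapF, eq_of_monic_of_associated hg.1 _ ha]
    exact monic_prod_of_monic _ _ fun i _ => (minpoly.monic (hint i)).pow _
  · rintro ε hε ⟨g, hg, hgD⟩
    rw [← hmapF] at hg
    have hg' := hinj hg
    have hgh : g * ∏ i, minpoly F (r i) ^ (k - ε i) = X ^ N - C lam := by
      rw [hg', ← Finset.prod_mul_distrib, ← hprodF]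
      refine Finset.prod_congr rfl fun i _ => ?_
      rw [← pow_add, Nat.add_sub_cancel' (hε i)]
    have hdual := hgD.dualCode hN hlam hgh
    refine ⟨hdual.isConstacyclic hN, _, ?_, hdual⟩
    rw [monicReverse_map, hmapF]
    exact (map_prod monicReverseHom _ _).trans
      (Finset.prod_congr rfl fun i _ => map_pow monicReverseHom _ _)

end FrobeniusOrbits

/-! ### Products over scaled powers of η: scaling, reciprocals and orbits. -/

section RootProd

variable {K : Type*} [Field K]

theorem hatScale_mul (f g : K[X]) (a : K) : hatScale (f * g) a = hatScale f a * hatScale g a := by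
  simp only [hatScale, mul_comp, leadingCoeff_mul, mul_inv, C_mul]
  ring

theorem hatScale_one (a : K) : hatScale (1 : K[X]) a = 1 := by
  simp [hatScale]

theorem hatScale_prod {ι : Type*} (s : Finset ι) (f : ι → K[X]) (a : K) :
    hatScale (∏ i ∈ s, f i) a = ∏ i ∈ s, hatScale (f i) a :=
  map_prod (⟨⟨fun f => hatScale f a, hatScale_one a⟩, fun f g => hatScale_mul f g a⟩ : K[X] →* K[X])
    f s

theorem hatScale_X_sub_C (r : K) {a : K} (ha : a ≠ 0) :
    hatScale (X - C r) a = X - C (r * a⁻¹) := by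
  have h : ((X - C r).comp (C a * X)) = C a * (X - C (r * a⁻¹)) := by
    rw [sub_comp, X_comp, C_comp, mul_sub, ← C_mul, mul_comm r, mul_inv_cancel_left₀ ha]
  rw [hatScale, h, leadingCoeff_mul, leadingCoeff_C, (monic_X_sub_C _).leadingCoeff, mul_one,
    ← mul_assoc, ← C_mul, inv_mul_cancel₀ ha, C_1, one_mul]

theorem hatScale_map {F : Type*} [Field F] (φ : F →+* K) (f : F[X]) (a : F) :
    (hatScale f a).map φ = hatScale (f.map φ) (φ a) := by
  have h : (f.map φ).comp (C (φ a) * X) = (f.comp (C a * X)).map φ := by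
    rw [Polynomial.map_comp]; simp
  rw [hatScale, hatScale, h, leadingCoeff_map]
  simp

theorem isGeneratorPolyOver_map_iff {F : Type*} [Field F] [Algebra F K] {N : ℕ} (lam : F)
    (D : Submodule F (Fin N → F)) (g : F[X]) :
    IsGeneratorPolyOver lam D (g.map (algebraMap F K)) ↔ IsGeneratorPoly lam D g := by
  constructor
  · rintro ⟨g', h, hg'⟩
    rwa [← map_injective _ (algebraMap F K).injective h]
  · exact fun h => ⟨g, rfl, h⟩

theorem mem_cyclotomicCoset {Q k : ℕ} [NeZero k] {s t : ZMod k} :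
    s ∈ cyclotomicCoset Q t ↔ ∃ j : ℕ, s = t * (Q : ZMod k) ^ j := by
  simp [cyclotomicCoset]

theorem neg_mem_cyclotomicCoset_neg {Q k : ℕ} [NeZero k] {s t : ZMod k} :
    s ∈ cyclotomicCoset Q (-t) ↔ -s ∈ cyclotomicCoset Q t := by
  simp only [mem_cyclotomicCoset, neg_mul, neg_eq_iff_eq_neg]

variable {k : ℕ}

/-- `∏ (X - η ^ s / γ)`, where `s` runs over `A`. -/
noncomputable def rootProd (η γ : K) (A : Finset (ZMod k)) : K[X] :=
  ∏ s ∈ A, (X - C (η ^ s.val * γ⁻¹))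

theorem rootProd_monic (η γ : K) (A : Finset (ZMod k)) : (rootProd η γ A).Monic :=
  monic_prod_of_monic _ _ fun _ _ => monic_X_sub_C _

theorem rootProd_splits (η γ : K) (A : Finset (ZMod k)) : (rootProd η γ A).Splits :=
  Splits.prod fun _ _ => Splits.X_sub_C _

theorem isRoot_rootProd {η γ : K} {A : Finset (ZMod k)} {x : K} :
    (rootProd η γ A).IsRoot x ↔ ∃ s ∈ A, x = η ^ s.val * γ⁻¹ := by
  simp [rootProd, IsRoot, eval_prod, Finset.prod_eq_zero_iff, sub_eq_zero]

/-- Scaling only multiplies `γ`, so every generator in the theorem becomes a product of powers of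
such polynomials. -/
theorem hatScale_rootProd (η γ : K) (A : Finset (ZMod k)) {b : K} (hb : b ≠ 0) :
    hatScale (rootProd η γ A) b = rootProd η (γ * b) A := by
  simp only [rootProd, hatScale_prod, hatScale_X_sub_C _ hb, mul_inv, mul_assoc]

theorem polyN_eq_rootProd [NeZero k] (q : ℕ) (η : K) (t : ZMod k) :
    polyN q η t = rootProd η 1 (cyclotomicCoset (q ^ 2) t) := by
  simp [polyN, rootProd]

variable {η : K}

theorem IsPrimitiveRoot.pow_val_natCast (hη : IsPrimitiveRoot η k) (j : ℕ) : η ^ (j : ZMod k).val = η ^ j := by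
  rw [ZMod.val_natCast, hη.eq_orderOf, pow_mod_orderOf]

theorem IsPrimitiveRoot.pow_val_mul_natCast [NeZero k] (hη : IsPrimitiveRoot η k) (s : ZMod k) (j : ℕ) :
    η ^ (s * j).val = (η ^ s.val) ^ j := by
  rw [← pow_mul, ← hη.pow_val_natCast (s.val * j), Nat.cast_mul, ZMod.natCast_zmod_val]

theorem IsPrimitiveRoot.pow_val_neg [NeZero k] (hη : IsPrimitiveRoot η k) (s : ZMod k) : η ^ (-s).val = (η ^ s.val)⁻¹ := by
  refine eq_inv_of_mul_eq_one_left ?_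
  rw [← pow_add, ← hη.pow_val_natCast]
  simp

theorem monicReverse_rootProd [NeZero k] (hη : IsPrimitiveRoot η k) {γ : K} (hγ : γ ≠ 0) {A B : Finset (ZMod k)}
    (h : ∀ s, s ∈ B ↔ -s ∈ A) : monicReverse (rootProd η γ A) = rootProd η γ⁻¹ B := by
  have h1 : monicReverse (rootProd η γ A) =
      ∏ s ∈ A, monicReverse (X - C (η ^ s.val * γ⁻¹)) := map_prod monicReverseHom _ _
  rw [h1, rootProd]
  refine Finset.prod_nbij' Neg.neg Neg.neg ?_ ?_ ?_ ?_ ?_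
  · intro s hs; simpa [h] using hs
  · intro s hs; exact (h s).1 hs
  · simp
  · simp
  · intro s _
    have h2 := monicReverse_X_pow_sub_C (lam := η ^ s.val * γ⁻¹) (N := 1)
      (mul_ne_zero (pow_ne_zero _ (hη.ne_zero (NeZero.ne k))) (inv_ne_zero hγ)) one_pos
    rw [pow_one] at h2
    rw [h2, hη.pow_val_neg, mul_inv]

theorem rootProd_univ [NeZero k] (hη : IsPrimitiveRoot η k) (γ : K) :
    rootProd η γ (Finset.univ : Finset (ZMod k)) = X ^ k - C (γ⁻¹ ^ k) := by
  classical
  have hk : 0 < k := Nat.pos_of_ne_zero (NeZero.ne k)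
  have hroot : nthRootsFinset k (1 : K) =
      (Finset.univ : Finset (ZMod k)).image fun s => η ^ s.val := by
    ext x
    simp only [mem_nthRootsFinset hk, Finset.mem_image, Finset.mem_univ, true_and]
    constructor
    · intro hx
      obtain ⟨i, -, rfl⟩ := hη.eq_pow_of_pow_eq_one hx
      exact ⟨i, hη.pow_val_natCast i⟩
    · rintro ⟨s, rfl⟩
      rw [← pow_mul, mul_comm, pow_mul, hη.pow_eq_one, one_pow]
  have hinj : Function.Injective fun s : ZMod k => η ^ s.val := fun s t hst =>
    ZMod.val_injective k (hη.pow_inj s.val_lt t.val_lt hst)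
  -- The factorization of x^k - y^k is applied in `K[X]` with x = X and y = γ⁻¹, so the roots of
  -- unity of `K[X]` must be known to be constants.
  have hC : nthRootsFinset k (1 : K[X]) = (nthRootsFinset k (1 : K)).image C := by
    have h1 := hη.map_of_injective (C_injective (R := K))
    refine (Finset.eq_of_subset_of_card_le ?_ ?_).symm
    · intro x hx
      obtain ⟨y, hy, rfl⟩ := Finset.mem_image.1 hx
      rw [mem_nthRootsFinset hk] at hy ⊢
      rw [← C_pow, hy, C_1]
    · rw [Finset.card_image_of_injective _ C_injective, hη.card_nthRootsFinset,
        h1.card_nthRootsFinset]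
  rw [C_pow, (hη.map_of_injective (C_injective (R := K))).pow_sub_pow_eq_prod_sub_mul X (C γ⁻¹) hk,
    hC, Finset.prod_image C_injective.injOn, hroot, Finset.prod_image hinj.injOn, rootProd]
  simp only [C_mul]

theorem rootProd_neg_univ [NeZero k] (hη : IsPrimitiveRoot η k) (hk : Odd k) (γ : K) :
    rootProd η γ (Finset.univ : Finset (ZMod k)) * rootProd η (-γ) (Finset.univ : Finset (ZMod k)) =
      X ^ (2 * k) - C (γ⁻¹ ^ (2 * k)) := by
  rw [rootProd_univ hη, rootProd_univ hη, inv_neg, hk.neg_pow, mul_comm 2, pow_mul, pow_mul]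
  simp only [map_neg, map_pow]
  ring

theorem isRoot_rootProd_cyclotomicCoset_iff [NeZero k] (hη : IsPrimitiveRoot η k) {q : ℕ} {γ : K} (hγ : γ ^ q = γ) (t : ZMod k) (x : K) :
    (rootProd η γ (cyclotomicCoset q t)).IsRoot x ↔ ∃ j : ℕ, x = (η ^ t.val * γ⁻¹) ^ q ^ j := by
  have hγ' : ∀ j : ℕ, γ ^ q ^ j = γ := fun j => by
    induction j with
    | zero => simp
    | succ j ih => rw [pow_succ, pow_mul, ih, hγ]
  simp only [isRoot_rootProd, mem_cyclotomicCoset, mul_pow, inv_pow, hγ',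
    ← hη.pow_val_mul_natCast, Nat.cast_pow]
  constructor
  · rintro ⟨s, ⟨j, rfl⟩, h⟩
    exact ⟨j, h⟩
  · rintro ⟨j, h⟩
    exact ⟨_, ⟨j, rfl⟩, h⟩

/-- Each q-th power multiplies the exponent by `q` and changes the sign of `γ`: even iterates fill
`A`, odd ones fill `B`. The sets are left abstract to serve both parities of f. -/
theorem exists_isRoot_rootProd_mul_iff [NeZero k] (hη : IsPrimitiveRoot η k) {q : ℕ} (hF : Odd q) {γ : K}
    (hγ : γ ^ q = -γ) (t : ZMod k)
    {A B : Finset (ZMod k)} (hA : ∀ s, s ∈ A ↔ ∃ j : ℕ, s = t * q ^ (2 * j))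
    (hB : ∀ s, s ∈ B ↔ ∃ j : ℕ, s = t * q ^ (2 * j + 1)) :
    ∃ r, ∀ x, (rootProd η γ A * rootProd η (-γ) B).IsRoot x ↔
      ∃ j : ℕ, x = r ^ q ^ j := by
  have hγ' : ∀ j : ℕ, γ ^ q ^ (2 * j) = γ ∧
      γ ^ q ^ (2 * j + 1) = -γ := fun j => by
    have h1 : ∀ i, γ ^ q ^ i = γ → γ ^ q ^ (i + 1) = -γ := fun i h => by
      rw [pow_succ, pow_mul, h, hγ]
    have h2 : γ ^ q ^ (2 * j) = γ := by
      induction j with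
      | zero => simp
      | succ j ih =>
        rw [show 2 * (j + 1) = 2 * j + 1 + 1 by ring, pow_succ, pow_mul, h1 _ ih, hF.neg_pow, hγ,
          neg_neg]
    exact ⟨h2, h1 _ h2⟩
  have hr : ∀ j : ℕ, (η ^ t.val * γ⁻¹) ^ q ^ j =
      η ^ (t * q ^ j).val * (γ ^ q ^ j)⁻¹ := fun j => by
    rw [mul_pow, inv_pow, ← hη.pow_val_mul_natCast, Nat.cast_pow]
  refine ⟨η ^ t.val * γ⁻¹, fun x => ?_⟩
  rw [IsRoot, eval_mul, mul_eq_zero, ← IsRoot, ← IsRoot, isRoot_rootProd, isRoot_rootProd]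
  simp only [hA, hB, hr]
  constructor
  · rintro (⟨s, ⟨j, rfl⟩, h⟩ | ⟨s, ⟨j, rfl⟩, h⟩)
    · exact ⟨2 * j, by rw [(hγ' j).1, h]⟩
    · exact ⟨2 * j + 1, by rw [(hγ' j).2, h]⟩
  · rintro ⟨j, h⟩
    rcases Nat.even_or_odd' j with ⟨i, rfl | rfl⟩
    · exact Or.inl ⟨_, ⟨i, rfl⟩, by rw [h, (hγ' i).1]⟩
    · exact Or.inr ⟨_, ⟨i, rfl⟩, by rw [h, (hγ' i).2]⟩

theorem map_polyM {F : Type*} [Field F] [Fintype F] [Algebra F K] [NeZero k]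
    (hη : IsPrimitiveRoot η k) (hk : (k : K) ≠ 0) (t : ZMod k) :
    (polyM F η t).map (algebraMap F K) = rootProd η 1 (cyclotomicCoset (Fintype.card F) t) := by
  have hk0 : 0 < k := Nat.pos_of_ne_zero (NeZero.ne k)
  refine map_minpoly_eq_of_isRoot_iff (rootProd_monic _ _ _) (rootProd_splits _ _ _) ?_ ?_ ?_
  · refine Separable.of_dvd ?_ (Finset.prod_dvd_prod_of_subset _ _ _ (Finset.subset_univ _))
    have := rootProd_univ hη 1
    rw [rootProd] at this
    rw [this]
    exact separable_X_pow_sub_C _ hk (by simp)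
  · intro x
    rw [isRoot_rootProd_cyclotomicCoset_iff hη (one_pow _), inv_one, mul_one]
  · refine IsIntegral.of_pow hk0 ?_
    rw [← pow_mul, mul_comm, pow_mul, hη.pow_eq_one, one_pow]
    exact isIntegral_one

end RootProd

/-! ### Cyclotomic cosets modulo ℓ^m and the parity of f. -/

section Cosets

variable {K : Type*} [Field K] {k : ℕ} [NeZero k]

theorem prod_rootProd_cyclotomicCoset {q e : ℕ} (η γ : K) {ρ : Fin e → ZMod k}
    (hρ : ∀ x : ZMod k, ∃! i, x ∈ cyclotomicCoset q (ρ i)) :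
    ∏ i, rootProd η γ (cyclotomicCoset q (ρ i)) = rootProd η γ (Finset.univ : Finset (ZMod k)) := by
  classical
  choose i hi hi' using hρ
  have h : ∀ j, cyclotomicCoset q (ρ j) = Finset.univ.filter fun x => i x = j := fun j => by
    ext x
    simp only [Finset.mem_filter, Finset.mem_univ, true_and]
    exact ⟨fun hx => (hi' x j hx).symm, fun hx => hx ▸ hi x⟩
  simp only [rootProd, h]
  exact Finset.prod_fiberwise _ _ _

theorem cyclotomicCoset_zero (q : ℕ) : cyclotomicCoset q (0 : ZMod k) = {0} := by
  ext s
  simp [mem_cyclotomicCoset]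

theorem mem_cyclotomicCoset_sq {q : ℕ} {s t : ZMod k} :
    s ∈ cyclotomicCoset (q ^ 2) t ↔ ∃ j : ℕ, s = t * (q : ZMod k) ^ (2 * j) := by
  simp only [mem_cyclotomicCoset, Nat.cast_pow, ← pow_mul]

theorem mem_cyclotomicCoset_sq_mul {q : ℕ} {s t : ZMod k} :
    s ∈ cyclotomicCoset (q ^ 2) (t * (q : ZMod k)) ↔ ∃ j : ℕ, s = t * (q : ZMod k) ^ (2 * j + 1) := by
  rw [mem_cyclotomicCoset_sq]
  simp only [pow_succ' (q : ZMod k), mul_assoc]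

/-- Otherwise `a - b` is prime to ℓ, hence a unit modulo ℓ^m, and it would kill the nonzero `t`. -/
theorem cast_eq_of_mul_eq_mul {ℓ m a b : ℕ} [hℓ : Fact ℓ.Prime] {t : ZMod (ℓ ^ m)} (ht : t ≠ 0)
    (h : t * a = t * b) : (a : ZMod ℓ) = b := by
  by_contra hab
  have h1 : IsCoprime ((a : ℤ) - b) ((ℓ ^ m : ℕ) : ℤ) := by
    rw [Nat.cast_pow]
    refine IsCoprime.pow_right (IsCoprime.symm ?_)
    refine (Prime.coprime_iff_not_dvd (Nat.prime_iff_prime_int.1 hℓ.out)).2 fun hd => hab ?_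
    have := (ZMod.intCast_zmod_eq_zero_iff_dvd _ _).2 hd
    push_cast at this
    exact sub_eq_zero.1 this
  obtain ⟨u, v, huv⟩ := h1
  apply ht
  have h2 := congrArg (Int.cast : ℤ → ZMod (ℓ ^ m)) huv
  push_cast at h2
  have h3 : ((ℓ : ZMod (ℓ ^ m)) ^ m) = 0 := by
    rw [← Nat.cast_pow, ZMod.natCast_self]
  linear_combination (-t) * h2 + u * h + t * v * h3

theorem pow_ne_pow_of_even_orderOf {G : Type*} [Monoid G] {x : G} (hx : 0 < orderOf x)
    (he : Even (orderOf x)) (i j : ℕ) : x ^ (2 * i) ≠ x ^ (2 * j + 1) := by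
  intro h
  have h1 := (IsOfFinOrder.pow_eq_pow_iff_modEq (orderOf_pos_iff.1 hx)).1 h
  have h2 := h1.of_dvd he.two_dvd
  rw [Nat.ModEq] at h2
  omega

theorem orderOf_natCast_pos {ℓ q : ℕ} [hℓ : Fact ℓ.Prime] (h : ¬ℓ ∣ q) :
    0 < orderOf (q : ZMod ℓ) := by
  have h0 : (q : ZMod ℓ) ≠ 0 := by rwa [Ne, ZMod.natCast_eq_zero_iff]
  have := orderOf_pos (Units.mk0 _ h0)
  rwa [← orderOf_units, Units.val_mk0] at this

/-- A common element of the two halves would equate an even and an odd power of `q` modulo ℓ,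
impossible when f is even. -/
theorem rootProd_cyclotomicCoset_eq_mul {ℓ m q : ℕ} [Fact ℓ.Prime] (h : ¬ℓ ∣ q)
    (he : Even (orderOf (q : ZMod ℓ))) (η γ : K) {t : ZMod (ℓ ^ m)} (ht : t ≠ 0) :
    rootProd η γ (cyclotomicCoset q t) =
      rootProd η γ (cyclotomicCoset (q ^ 2) t) *
        rootProd η γ (cyclotomicCoset (q ^ 2) (t * (q : ZMod (ℓ ^ m)))) := by
  classical
  rw [rootProd, rootProd, rootProd, ← Finset.prod_union]
  · congr 1
    ext s
    rw [Finset.mem_union, mem_cyclotomicCoset_sq, mem_cyclotomicCoset_sq_mul, mem_cyclotomicCoset]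
    constructor
    · rintro ⟨j, rfl⟩
      rcases Nat.even_or_odd' j with ⟨i, rfl | rfl⟩
      · exact Or.inl ⟨i, rfl⟩
      · exact Or.inr ⟨i, rfl⟩
    · rintro (⟨j, rfl⟩ | ⟨j, rfl⟩)
      · exact ⟨_, rfl⟩
      · exact ⟨_, rfl⟩
  · rw [Finset.disjoint_left]
    intro s hs hs'
    obtain ⟨i, rfl⟩ := mem_cyclotomicCoset_sq.1 hs
    obtain ⟨j, hj⟩ := mem_cyclotomicCoset_sq_mul.1 hs'
    rw [← Nat.cast_pow, ← Nat.cast_pow] at hj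
    have := cast_eq_of_mul_eq_mul ht hj
    rw [Nat.cast_pow, Nat.cast_pow] at this
    exact pow_ne_pow_of_even_orderOf (orderOf_natCast_pos h) he i j this

/-- Raising a congruence to 1 modulo ℓ to the power ℓ^(m-1) lifts it to ℓ^m, so T = f · ℓ^(m-1)
works. -/
theorem exists_odd_pow_eq_one {ℓ m q : ℕ} (hm : 0 < m) (hℓ : Odd ℓ)
    (ho : Odd (orderOf (q : ZMod ℓ))) : ∃ T, Odd T ∧ (q : ZMod (ℓ ^ m)) ^ T = 1 := by
  obtain ⟨m, rfl⟩ := Nat.exists_eq_succ_of_ne_zero hm.ne'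
  refine ⟨orderOf (q : ZMod ℓ) * ℓ ^ m, ho.mul hℓ.pow, ?_⟩
  have h1 : ((ℓ : ℕ) : ℤ) ∣ (q : ℤ) ^ orderOf (q : ZMod ℓ) - 1 := by
    rw [← ZMod.intCast_zmod_eq_zero_iff_dvd]
    push_cast
    rw [pow_orderOf_eq_one, sub_self]
  have h2 := dvd_sub_pow_of_dvd_sub h1 m
  rw [one_pow, ← pow_mul, ← Nat.cast_pow, ← ZMod.intCast_zmod_eq_zero_iff_dvd] at h2
  push_cast at h2
  exact sub_eq_zero.1 h2

/-- Adding `T` to the exponent changes its parity but not the power. -/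
theorem mem_cyclotomicCoset_iff_of_odd_pow_eq_one {q T : ℕ} (hT : Odd T)
    (h : (q : ZMod k) ^ T = 1) (s t : ZMod k) :
    (s ∈ cyclotomicCoset q t ↔ ∃ j : ℕ, s = t * (q : ZMod k) ^ (2 * j)) ∧
      (s ∈ cyclotomicCoset q t ↔ ∃ j : ℕ, s = t * (q : ZMod k) ^ (2 * j + 1)) := by
  obtain ⟨c, rfl⟩ := hT
  constructor
  · rw [mem_cyclotomicCoset]
    refine ⟨?_, fun ⟨j, hj⟩ => ⟨_, hj⟩⟩
    rintro ⟨j, rfl⟩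
    rcases Nat.even_or_odd' j with ⟨i, rfl | rfl⟩
    · exact ⟨i, rfl⟩
    · refine ⟨i + c + 1, ?_⟩
      rw [show 2 * (i + c + 1) = 2 * i + 1 + (2 * c + 1) by ring, pow_add _ (2 * i + 1), h, mul_one]
  · rw [mem_cyclotomicCoset]
    refine ⟨?_, fun ⟨j, hj⟩ => ⟨_, hj⟩⟩
    rintro ⟨j, rfl⟩
    rcases Nat.even_or_odd' j with ⟨i, rfl | rfl⟩
    · refine ⟨i + c, ?_⟩
      rw [show 2 * (i + c) + 1 = 2 * i + (2 * c + 1) by ring, pow_add _ (2 * i), h, mul_one]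
    · exact ⟨i, rfl⟩

end Cosets

/-! ### Generator polynomials for the three orbit shapes. -/

section Codes

variable {F K : Type*} [Field F] [Fintype F] [Field K] [Algebra F K]

theorem X_pow_sub_C_pow_char_pow {p : ℕ} [Fact p.Prime] [CharP K p] {d n : ℕ} {γ lam : K}
    (h : γ ^ (d * p ^ n) * lam = 1) :
    (X ^ d - C (γ⁻¹ ^ d)) ^ p ^ n = (X ^ (d * p ^ n) - C lam : K[X]) := by
  rw [sub_pow_char_pow, ← pow_mul, ← C_pow, ← pow_mul, inv_pow, eq_inv_of_mul_eq_one_right h]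

/-- The hypotheses shared by the three shapes of generator polynomials. -/
structure RootData (F : Type*) {K : Type*} [Field F] [Fintype F] [Field K] [Algebra F K]
    (p n k : ℕ) (η γ : K) (lam : F) : Prop where
  prime : Fact p.Prime
  charP : CharP K p
  odd : Odd k
  ne_zero : ((2 * k : ℕ) : K) ≠ 0
  isPrimitiveRoot : IsPrimitiveRoot η k
  pow_mul_eq : γ ^ (2 * k * p ^ n) * algebraMap F K lam = 1

variable {p n k : ℕ} {η γ : K} {lam : F}

theorem RootData.γ_ne_zero (h : RootData F p n k η γ lam) : γ ≠ 0 := by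
  have := h.prime
  rintro rfl
  have h1 := h.pow_mul_eq
  rw [zero_pow (mul_ne_zero (mul_ne_zero two_ne_zero h.odd.pos.ne')
    (pow_ne_zero _ (NeZero.ne p))), zero_mul] at h1
  exact zero_ne_one h1

theorem RootData.isGeneratorPolyOver [NeZero k] (h : RootData F p n k η γ lam)
    {ι : Type*} [Fintype ι] (G : ι → K[X]) (hm : ∀ i, (G i).Monic) (hs : ∀ i, (G i).Splits)
    (horb : ∀ i, ∃ r, ∀ x, (G i).IsRoot x ↔ ∃ j : ℕ, x = r ^ Fintype.card F ^ j)
    (hprod : ∏ i, G i = rootProd η γ (Finset.univ : Finset (ZMod k)) *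
      rootProd η (-γ) (Finset.univ : Finset (ZMod k)))
    (D : Submodule F (Fin (2 * k * p ^ n) → F)) (hD : IsConstacyclic lam D) :
    (∃ ε : ι → ℕ, (∀ i, ε i ≤ p ^ n) ∧ IsGeneratorPolyOver lam D (∏ i, G i ^ ε i)) ∧
    ∀ ε : ι → ℕ, (∀ i, ε i ≤ p ^ n) → IsGeneratorPolyOver lam D (∏ i, G i ^ ε i) →
      IsConstacyclic lam⁻¹ (dualCode D) ∧
      IsGeneratorPolyOver lam⁻¹ (dualCode D) (∏ i, monicReverse (G i) ^ (p ^ n - ε i)) := by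
  have := h.prime
  have := h.charP
  have hp : 0 < p := NeZero.pos p
  have hk := h.odd.pos
  have hlam : lam ≠ 0 := by
    rintro rfl
    simpa using h.pow_mul_eq
  rw [rootProd_neg_univ h.isPrimitiveRoot h.odd] at hprod
  refine isGeneratorPolyOver_of_orbits (by positivity) (by positivity) hlam G hm hs ?_ horb ?_ D hD
  · rw [hprod]
    exact separable_X_pow_sub_C _ h.ne_zero (pow_ne_zero _ (inv_ne_zero h.γ_ne_zero))
  · rw [hprod, X_pow_sub_C_pow_char_pow h.pow_mul_eq]

theorem RootData.isGeneratorPolyOver_of_pow_card_eq [NeZero k] (h : RootData F p n k η γ lam)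
    (hγ : γ ^ Fintype.card F = γ) (hF : Odd (Fintype.card F)) {e : ℕ} {ρ : Fin e → ZMod k}
    (hρ : ∀ x : ZMod k, ∃! i, x ∈ cyclotomicCoset (Fintype.card F) (ρ i))
    (D : Submodule F (Fin (2 * k * p ^ n) → F)) (hD : IsConstacyclic lam D) :
    (∃ ε ε' : Fin e → ℕ, (∀ i, ε i ≤ p ^ n ∧ ε' i ≤ p ^ n) ∧ IsGeneratorPolyOver lam D
      (∏ i, rootProd η γ (cyclotomicCoset (Fintype.card F) (ρ i)) ^ ε i *
        rootProd η (-γ) (cyclotomicCoset (Fintype.card F) (ρ i)) ^ ε' i)) ∧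
    ∀ ε ε' : Fin e → ℕ, (∀ i, ε i ≤ p ^ n ∧ ε' i ≤ p ^ n) → IsGeneratorPolyOver lam D
      (∏ i, rootProd η γ (cyclotomicCoset (Fintype.card F) (ρ i)) ^ ε i *
        rootProd η (-γ) (cyclotomicCoset (Fintype.card F) (ρ i)) ^ ε' i) →
      IsConstacyclic lam⁻¹ (dualCode D) ∧ IsGeneratorPolyOver lam⁻¹ (dualCode D)
      (∏ i, rootProd η γ⁻¹ (cyclotomicCoset (Fintype.card F) (-ρ i)) ^ (p ^ n - ε i) *
        rootProd η (-γ⁻¹) (cyclotomicCoset (Fintype.card F) (-ρ i)) ^ (p ^ n - ε' i)) := by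
  have hγ' : (-γ) ^ Fintype.card F = -γ := by rw [hF.neg_pow, hγ]
  have hη := h.isPrimitiveRoot
  have key := h.isGeneratorPolyOver
    (Sum.elim (fun i => rootProd η γ (cyclotomicCoset (Fintype.card F) (ρ i)))
      (fun i => rootProd η (-γ) (cyclotomicCoset (Fintype.card F) (ρ i))))
    (by rintro (i | i) <;> exact rootProd_monic _ _ _)
    (by rintro (i | i) <;> exact rootProd_splits _ _ _)
    (by
      rintro (i | i)
      · exact ⟨_, isRoot_rootProd_cyclotomicCoset_iff hη hγ _⟩
      · exact ⟨_, isRoot_rootProd_cyclotomicCoset_iff hη hγ' _⟩)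
    (by simp only [Fintype.prod_sum_type, Sum.elim_inl, Sum.elim_inr,
          prod_rootProd_cyclotomicCoset _ _ hρ]) D hD
  simp only [Fintype.prod_sum_type, Sum.elim_inl, Sum.elim_inr, ← Finset.prod_mul_distrib,
    Sum.forall] at key
  have hrev : ∀ i, monicReverse (rootProd η γ (cyclotomicCoset (Fintype.card F) (ρ i))) =
      rootProd η γ⁻¹ (cyclotomicCoset (Fintype.card F) (-ρ i)) := fun i =>
    monicReverse_rootProd hη h.γ_ne_zero fun s => neg_mem_cyclotomicCoset_neg
  have hrev' : ∀ i, monicReverse (rootProd η (-γ) (cyclotomicCoset (Fintype.card F) (ρ i))) =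
      rootProd η (-γ⁻¹) (cyclotomicCoset (Fintype.card F) (-ρ i)) := fun i => by
    rw [← inv_neg]
    exact monicReverse_rootProd hη (neg_ne_zero.2 h.γ_ne_zero) fun s => neg_mem_cyclotomicCoset_neg
  simp only [hrev, hrev'] at key
  obtain ⟨⟨ε, hε, hg⟩, key⟩ := key
  refine ⟨⟨fun i => ε (Sum.inl i), fun i => ε (Sum.inr i), fun i => ⟨hε.1 i, hε.2 i⟩, hg⟩, ?_⟩
  intro ε ε' hε hg
  exact key (Sum.elim ε ε') ⟨fun i => (hε i).1, fun i => (hε i).2⟩ hg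

/-- `∏ (X - η ^ s / γ) ∏ (X + η ^ t / γ)`, where `s` runs over `A` and `t` over `B`. -/
noncomputable def signedRootProd (η γ : K) (A B : Finset (ZMod k)) : K[X] :=
  rootProd η γ A * rootProd η (-γ) B

theorem monicReverse_signedRootProd [NeZero k] (hη : IsPrimitiveRoot η k) (hγ : γ ≠ 0)
    (Q Q' : ℕ) (s t : ZMod k) :
    monicReverse (signedRootProd η γ (cyclotomicCoset Q s) (cyclotomicCoset Q' t)) =
      signedRootProd η γ⁻¹ (cyclotomicCoset Q (-s)) (cyclotomicCoset Q' (-t)) := by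
  rw [signedRootProd, monicReverse_mul,
    monicReverse_rootProd hη hγ (fun _ => neg_mem_cyclotomicCoset_neg),
    monicReverse_rootProd hη (neg_ne_zero.2 hγ) (fun _ => neg_mem_cyclotomicCoset_neg),
    inv_neg, signedRootProd]

theorem RootData.isGeneratorPolyOver_of_odd [NeZero k] (h : RootData F p n k η γ lam)
    (hγ : γ ^ Fintype.card F = -γ) (hF : Odd (Fintype.card F)) {e : ℕ} {ρ : Fin e → ZMod k}
    (hρ : ∀ x : ZMod k, ∃! i, x ∈ cyclotomicCoset (Fintype.card F) (ρ i))
    {T : ℕ} (hT : Odd T) (hqT : (Fintype.card F : ZMod k) ^ T = 1)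
    (D : Submodule F (Fin (2 * k * p ^ n) → F)) (hD : IsConstacyclic lam D) :
    (∃ ε : Fin e → ℕ, (∀ i, ε i ≤ p ^ n) ∧ IsGeneratorPolyOver lam D
      (∏ i, signedRootProd η γ (cyclotomicCoset (Fintype.card F) (ρ i))
        (cyclotomicCoset (Fintype.card F) (ρ i)) ^ ε i)) ∧
    ∀ ε : Fin e → ℕ, (∀ i, ε i ≤ p ^ n) → IsGeneratorPolyOver lam D
      (∏ i, signedRootProd η γ (cyclotomicCoset (Fintype.card F) (ρ i))
        (cyclotomicCoset (Fintype.card F) (ρ i)) ^ ε i) →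
      IsConstacyclic lam⁻¹ (dualCode D) ∧ IsGeneratorPolyOver lam⁻¹ (dualCode D)
      (∏ i, signedRootProd η γ⁻¹ (cyclotomicCoset (Fintype.card F) (-ρ i))
        (cyclotomicCoset (Fintype.card F) (-ρ i)) ^ (p ^ n - ε i)) := by
  have key := h.isGeneratorPolyOver
    (fun i => signedRootProd η γ (cyclotomicCoset (Fintype.card F) (ρ i))
        (cyclotomicCoset (Fintype.card F) (ρ i)))
    (fun i => (rootProd_monic _ _ _).mul (rootProd_monic _ _ _))
    (fun i => (rootProd_splits _ _ _).mul (rootProd_splits _ _ _))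
    (fun i => exists_isRoot_rootProd_mul_iff h.isPrimitiveRoot hF hγ (ρ i)
      (fun s => (mem_cyclotomicCoset_iff_of_odd_pow_eq_one hT hqT s _).1)
      (fun s => (mem_cyclotomicCoset_iff_of_odd_pow_eq_one hT hqT s _).2))
    (by simp only [signedRootProd, Finset.prod_mul_distrib, prod_rootProd_cyclotomicCoset _ _ hρ])
    D hD
  simpa only [monicReverse_signedRootProd h.isPrimitiveRoot h.γ_ne_zero] using key

theorem RootData.isGeneratorPolyOver_of_even {ℓ m : ℕ} [Fact ℓ.Prime]
    (h : RootData F p n (ℓ ^ m) η γ lam)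
    (hγ : γ ^ Fintype.card F = -γ) (hF : Odd (Fintype.card F)) {e : ℕ}
    {ρ : Fin (e + 1) → ZMod (ℓ ^ m)} (hρ0 : ρ 0 = 0)
    (hρ : ∀ x : ZMod (ℓ ^ m), ∃! i, x ∈ cyclotomicCoset (Fintype.card F) (ρ i))
    (hℓF : ¬ℓ ∣ Fintype.card F) (he : Even (orderOf (Fintype.card F : ZMod ℓ)))
    (D : Submodule F (Fin (2 * ℓ ^ m * p ^ n) → F)) (hD : IsConstacyclic lam D) :
    (∃ (ε₀ : ℕ) (ε ε' : Fin e → ℕ), ε₀ ≤ p ^ n ∧ (∀ i, ε i ≤ p ^ n ∧ ε' i ≤ p ^ n) ∧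
      IsGeneratorPolyOver lam D
      (signedRootProd η γ ({0} : Finset (ZMod (ℓ ^ m))) {0} ^ ε₀ *
        ∏ i : Fin e, signedRootProd η γ (cyclotomicCoset (Fintype.card F ^ 2) (ρ i.succ))
          (cyclotomicCoset (Fintype.card F ^ 2) (ρ i.succ * (Fintype.card F : ZMod (ℓ ^ m)))) ^ ε i *
        signedRootProd η γ (cyclotomicCoset (Fintype.card F ^ 2) (ρ i.succ * (Fintype.card F : ZMod (ℓ ^ m))))
          (cyclotomicCoset (Fintype.card F ^ 2) (ρ i.succ)) ^ ε' i)) ∧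
    ∀ (ε₀ : ℕ) (ε ε' : Fin e → ℕ), ε₀ ≤ p ^ n → (∀ i, ε i ≤ p ^ n ∧ ε' i ≤ p ^ n) →
      IsGeneratorPolyOver lam D
      (signedRootProd η γ ({0} : Finset (ZMod (ℓ ^ m))) {0} ^ ε₀ *
        ∏ i : Fin e, signedRootProd η γ (cyclotomicCoset (Fintype.card F ^ 2) (ρ i.succ))
          (cyclotomicCoset (Fintype.card F ^ 2) (ρ i.succ * (Fintype.card F : ZMod (ℓ ^ m)))) ^ ε i *
        signedRootProd η γ (cyclotomicCoset (Fintype.card F ^ 2) (ρ i.succ * (Fintype.card F : ZMod (ℓ ^ m))))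
          (cyclotomicCoset (Fintype.card F ^ 2) (ρ i.succ)) ^ ε' i) →
      IsConstacyclic lam⁻¹ (dualCode D) ∧ IsGeneratorPolyOver lam⁻¹ (dualCode D)
      (signedRootProd η γ⁻¹ ({0} : Finset (ZMod (ℓ ^ m))) {0} ^ (p ^ n - ε₀) *
        ∏ i : Fin e, signedRootProd η γ⁻¹ (cyclotomicCoset (Fintype.card F ^ 2) (-ρ i.succ))
          (cyclotomicCoset (Fintype.card F ^ 2) (-ρ i.succ * (Fintype.card F : ZMod (ℓ ^ m)))) ^ (p ^ n - ε i) *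
        signedRootProd η γ⁻¹ (cyclotomicCoset (Fintype.card F ^ 2) (-ρ i.succ * (Fintype.card F : ZMod (ℓ ^ m))))
          (cyclotomicCoset (Fintype.card F ^ 2) (-ρ i.succ)) ^ (p ^ n - ε' i)) := by
  have hη := h.isPrimitiveRoot
  have hne : ∀ i : Fin e, ρ i.succ ≠ 0 := fun i hi => by
    have h1 : (0 : ZMod (ℓ ^ m)) ∈ cyclotomicCoset (Fintype.card F) (ρ i.succ) :=
      mem_cyclotomicCoset.2 ⟨0, by simp [hi]⟩
    have h2 : (0 : ZMod (ℓ ^ m)) ∈ cyclotomicCoset (Fintype.card F) (ρ 0) :=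
      mem_cyclotomicCoset.2 ⟨0, by simp [hρ0]⟩
    exact Fin.succ_ne_zero i ((hρ 0).unique h1 h2)
  have hγ' : (-γ) ^ Fintype.card F = -(-γ) := by rw [hF.neg_pow, hγ]
  have hP : ∀ (c : K) (i : Fin e), rootProd η c (cyclotomicCoset (Fintype.card F ^ 2) (ρ i.succ)) *
      rootProd η c (cyclotomicCoset (Fintype.card F ^ 2) (ρ i.succ * (Fintype.card F : ZMod (ℓ ^ m)))) =
        rootProd η c (cyclotomicCoset (Fintype.card F) (ρ i.succ)) := fun c i =>
    (rootProd_cyclotomicCoset_eq_mul hℓF he η c (hne i)).symm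
  have hU : ∀ c : K, rootProd η c (Finset.univ : Finset (ZMod (ℓ ^ m))) = rootProd η c {0} *
      ∏ i : Fin e, rootProd η c (cyclotomicCoset (Fintype.card F) (ρ i.succ)) := fun c => by
    rw [← prod_rootProd_cyclotomicCoset η c hρ, Fin.prod_univ_succ, hρ0, cyclotomicCoset_zero]
  -- `none` is the orbit {1/γ, -1/γ} of exponent 0, which does not split; the two summands index the
  -- Q_i and the R_i.
  have key := h.isGeneratorPolyOver (ι := Option (Fin e ⊕ Fin e))
    (fun o => o.elim (signedRootProd η γ ({0} : Finset (ZMod (ℓ ^ m))) {0}) (Sum.elim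
      (fun i => signedRootProd η γ (cyclotomicCoset (Fintype.card F ^ 2) (ρ i.succ))
          (cyclotomicCoset (Fintype.card F ^ 2) (ρ i.succ * (Fintype.card F : ZMod (ℓ ^ m)))))
      (fun i => signedRootProd η γ
          (cyclotomicCoset (Fintype.card F ^ 2) (ρ i.succ * (Fintype.card F : ZMod (ℓ ^ m))))
          (cyclotomicCoset (Fintype.card F ^ 2) (ρ i.succ)))))
    (by rintro (_ | i | i) <;> exact (rootProd_monic _ _ _).mul (rootProd_monic _ _ _))
    (by rintro (_ | i | i) <;> exact (rootProd_splits _ _ _).mul (rootProd_splits _ _ _))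
    (by
      rintro (_ | i | i)
      · exact exists_isRoot_rootProd_mul_iff hη hF hγ 0 (by simp) (by simp)
      · exact exists_isRoot_rootProd_mul_iff hη hF hγ (ρ i.succ)
          (fun s => mem_cyclotomicCoset_sq) (fun s => mem_cyclotomicCoset_sq_mul)
      -- R_i is Q_i with `-γ` in place of `γ`.
      · have := exists_isRoot_rootProd_mul_iff hη hF hγ' (ρ i.succ)
          (fun s => mem_cyclotomicCoset_sq) (fun s => mem_cyclotomicCoset_sq_mul)
        rw [neg_neg, mul_comm] at this
        exact this)
    (by
      simp only [Fintype.prod_option, Fintype.prod_sum_type, Option.elim, Sum.elim_inl,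
        Sum.elim_inr, signedRootProd, hU, ← hP, Finset.prod_mul_distrib]
      ring) D hD
  have hrev0 : monicReverse (signedRootProd η γ ({0} : Finset (ZMod (ℓ ^ m))) {0}) =
      signedRootProd η γ⁻¹ ({0} : Finset (ZMod (ℓ ^ m))) {0} := by
    -- The multiplier 1 is arbitrary, since every coset of 0 is {0}.
    have := monicReverse_signedRootProd hη h.γ_ne_zero 1 1 0 0
    rwa [neg_zero, cyclotomicCoset_zero] at this
  simp only [Fintype.prod_option, Fintype.prod_sum_type, Option.elim, Sum.elim_inl,
    Sum.elim_inr, Option.forall, Sum.forall, hrev0, ← Finset.prod_mul_distrib,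
    monicReverse_signedRootProd hη h.γ_ne_zero] at key
  simp only [neg_mul]
  obtain ⟨⟨ε, hε, hg⟩, key⟩ := key
  refine ⟨⟨ε none, fun i => ε (some (Sum.inl i)), fun i => ε (some (Sum.inr i)), hε.1,
    fun i => ⟨hε.2.1 i, hε.2.2 i⟩, hg⟩, ?_⟩
  intro ε₀ ε ε' hε₀ hε hg
  exact key (fun o => o.elim ε₀ (Sum.elim ε ε'))
    ⟨hε₀, fun i => (hε i).1, fun i => (hε i).2⟩ hg

end Codes

/-! ### Existence of a and b, and the sign of β₁ under Frobenius. -/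

section Arithmetic

theorem exists_pow_eq_of_coprime {G : Type*} [Group G] {M : ℕ} (h : (Nat.card G).Coprime M)
    (z : G) : ∃ y, y ^ M = z :=
  (powCoprime h).surjective z

theorem exists_pow_mul_eq_one_of_mem_zpowers_sq {G : Type*} [Group G] {M : ℕ}
    (h : (Nat.card G).Coprime M) {ξ lam : G} (hlam : lam ∈ Subgroup.zpowers (ξ ^ 2)) :
    ∃ a : G, a ^ (2 * M) * lam = 1 := by
  obtain ⟨i, rfl⟩ := Subgroup.mem_zpowers_iff.1 hlam
  obtain ⟨y, hy⟩ := exists_pow_eq_of_coprime h (ξ ^ (-i))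
  refine ⟨y, ?_⟩
  rw [mul_comm 2, pow_mul, hy, ← zpow_natCast, ← zpow_natCast, ← zpow_mul, ← zpow_mul, ← zpow_add,
    show -i * ((2 : ℕ) : ℤ) + ((2 : ℕ) : ℤ) * i = 0 by ring, zpow_zero]

/-- Here `lam` and ξ^r are both odd powers of `ξ`, so their quotient is a square, and `M`-th roots
exist by coprimality. -/
theorem exists_pow_mul_eq_pow_of_notMem_zpowers_sq {G : Type*} [Group G] {M r : ℕ}
    (h : (Nat.card G).Coprime M) (hr : Odd r) {ξ lam : G} (hξ : lam ∈ Subgroup.zpowers ξ)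
    (hlam : lam ∉ Subgroup.zpowers (ξ ^ 2)) :
    ∃ b : G, b ^ (2 * M) * lam = ξ ^ r := by
  obtain ⟨j, rfl⟩ := Subgroup.mem_zpowers_iff.1 hξ
  rcases Int.even_or_odd' j with ⟨i, rfl | rfl⟩
  · exact absurd (Subgroup.mem_zpowers_iff.2 ⟨i, by
      rw [← zpow_natCast, ← zpow_mul]; rfl⟩) hlam
  · obtain ⟨c, rfl⟩ := hr
    obtain ⟨y, hy⟩ := exists_pow_eq_of_coprime h (ξ ^ ((c : ℤ) - i))
    refine ⟨y, ?_⟩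
    rw [mul_comm 2, pow_mul, hy, ← zpow_natCast, ← zpow_natCast, ← zpow_mul, ← zpow_add]
    congr 1
    push_cast
    ring

/-- β^(q-1) is a primitive square root of unity, that is -1. -/
theorem IsPrimitiveRoot.pow_eq_neg_of_two_mul {K : Type*} [Field K] {β : K} {q : ℕ} (hq : 1 < q)
    (hβ : IsPrimitiveRoot β (2 * (q - 1))) : β ^ q = -β := by
  have h := (hβ.pow (by omega) (mul_comm 2 (q - 1))).eq_neg_one_of_two_right
  obtain ⟨r, rfl⟩ := Nat.exists_eq_add_of_lt hq
  rw [show 1 + r + 1 - 1 = 1 + r by omega] at h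
  rw [pow_succ, h, neg_one_mul]

theorem card_units_coprime {F : Type*} [Field F] [Fintype F] (p ℓ m n : ℕ) [Fact p.Prime]
    [CharP F p] (h : Nat.gcd ℓ (Fintype.card F - 1) = 1) :
    (Nat.card Fˣ).Coprime (ℓ ^ m * p ^ n) := by
  classical
  rw [Nat.card_eq_fintype_card, Fintype.card_units]
  refine Nat.Coprime.mul_right (Nat.Coprime.pow_right _ (Nat.Coprime.symm h)) ?_
  refine Nat.Coprime.pow_right _ (Nat.Coprime.symm ?_)
  obtain ⟨k, hp, hk⟩ := FiniteField.card F p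
  rw [hk, hp.coprime_iff_not_dvd]
  intro hd
  have h1 : p ∣ p ^ (k : ℕ) := dvd_pow_self _ k.ne_zero
  have h2 : p ∣ 1 := by
    have := (Nat.dvd_sub h1 hd)
    rwa [Nat.sub_sub_self (Nat.one_le_pow _ _ hp.pos)] at this
  exact hp.one_lt.ne' (Nat.dvd_one.1 h2)

end Arithmetic

/-! ### The polynomials of the statement as root products. -/

section HatScale

variable {K : Type*} [Field K] {k : ℕ} {η : K}

theorem hatScale_signedRootProd {γ b : K} (hb : b ≠ 0) (A B : Finset (ZMod k)) :
    hatScale (signedRootProd η γ A B) b = signedRootProd η (γ * b) A B := by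
  rw [signedRootProd, hatScale_mul, hatScale_rootProd _ _ _ hb, hatScale_rootProd _ _ _ hb,
    signedRootProd, neg_mul]

theorem hatScale_X_sub_C_mul_X_add_C (η : K) {β b : K} (hb : b ≠ 0) :
    hatScale ((X - C β⁻¹) * (X + C β⁻¹)) b =
      signedRootProd η (β * b) ({0} : Finset (ZMod k)) {0} := by
  rw [← hatScale_signedRootProd hb]
  simp [signedRootProd, rootProd, inv_neg]

variable [NeZero k]

theorem hatScale_polyN (q : ℕ) (t : ZMod k) {β : K} (hβ : β ≠ 0) :
    hatScale (polyN q η t) β = rootProd η β (cyclotomicCoset (q ^ 2) t) := by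
  rw [polyN_eq_rootProd, hatScale_rootProd _ _ _ hβ, one_mul]

theorem hatScale_polyQ (q : ℕ) (t : ZMod k) {β b : K} (hβ : β ≠ 0) (hb : b ≠ 0) :
    hatScale (polyQ q η β t) b = signedRootProd η (β * b) (cyclotomicCoset (q ^ 2) t)
      (cyclotomicCoset (q ^ 2) (t * (q : ZMod k))) := by
  rw [polyQ, hatScale_polyN _ _ hβ, hatScale_polyN _ _ (neg_ne_zero.2 hβ), ← signedRootProd,
    hatScale_signedRootProd hb]

theorem hatScale_polyR (q : ℕ) (t : ZMod k) {β b : K} (hβ : β ≠ 0) (hb : b ≠ 0) :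
    hatScale (polyR q η β t) b = signedRootProd η (β * b)
      (cyclotomicCoset (q ^ 2) (t * (q : ZMod k))) (cyclotomicCoset (q ^ 2) t) := by
  rw [polyR, hatScale_polyN _ _ hβ, hatScale_polyN _ _ (neg_ne_zero.2 hβ), ← signedRootProd,
    hatScale_signedRootProd hb]

variable {F : Type*} [Field F] [Fintype F] [Algebra F K]

theorem hatScale_map_polyM (hη : IsPrimitiveRoot η k) (hk : (k : K) ≠ 0) (t : ZMod k) {β : K}
    (hβ : β ≠ 0) : hatScale ((polyM F η t).map (algebraMap F K)) β =
      rootProd η β (cyclotomicCoset (Fintype.card F) t) := by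
  rw [map_polyM hη hk, hatScale_rootProd _ _ _ hβ, one_mul]

theorem hatScale_polyS (hη : IsPrimitiveRoot η k) (hk : (k : K) ≠ 0) (t : ZMod k) {β b : K}
    (hβ : β ≠ 0) (hb : b ≠ 0) : hatScale (polyS F η β t) b =
      signedRootProd η (β * b) (cyclotomicCoset (Fintype.card F) t)
        (cyclotomicCoset (Fintype.card F) t) := by
  rw [polyS, hatScale_map_polyM hη hk _ hβ, hatScale_map_polyM hη hk _ (neg_ne_zero.2 hβ),
    ← signedRootProd, hatScale_signedRootProd hb]

theorem map_prod_hatScale_polyM (hη : IsPrimitiveRoot η k) (hk : (k : K) ≠ 0) {e : ℕ}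
    (τ : Fin e → ZMod k) {a : F} (ha : a ≠ 0) (ε ε' : Fin e → ℕ) :
    (∏ i, hatScale (polyM F η (τ i)) a ^ ε i *
      hatScale (polyM F η (τ i)) (-a) ^ ε' i).map (algebraMap F K) =
    ∏ i, rootProd η (algebraMap F K a) (cyclotomicCoset (Fintype.card F) (τ i)) ^ ε i *
      rootProd η (-algebraMap F K a) (cyclotomicCoset (Fintype.card F) (τ i)) ^ ε' i := by
  have ha' : algebraMap F K a ≠ 0 := by simpa using ha
  simp only [Polynomial.map_prod, Polynomial.map_mul, Polynomial.map_pow, hatScale_map, map_neg,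
    hatScale_map_polyM hη hk _ ha', hatScale_map_polyM hη hk _ (neg_ne_zero.2 ha')]

end HatScale
-- Choice of γ in each case and conclusion.
theorem mainTheorem3
    {F K : Type*} [Field F] [Fintype F] [Field K] [Algebra F K]
    (p ℓ m n q : ℕ) [Fact p.Prime] [CharP F p] [Fact ℓ.Prime]
    (hp : Odd p) (hℓ : Odd ℓ) (hℓp : ℓ ≠ p) (hm : 0 < m)
    (hq : q = Fintype.card F) (hcop : Nat.gcd ℓ (q - 1) = 1)
    -- a generator of the multiplicative group of `F`
    (ξ : Fˣ) (hξ : ∀ x : Fˣ, x ∈ Subgroup.zpowers ξ)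
    (η : K) (hη : IsPrimitiveRoot η (ℓ ^ m))
    -- a square root of `ξ`, and the element `β₁` attached to it
    (α₁ β₁ : K) (hα₁ : α₁ ^ 2 = algebraMap F K (ξ : F))
    (hβ₁ : IsPrimitiveRoot β₁ (2 * (q - 1))) (hαβ : β₁ ^ ℓ ^ m * α₁ = 1)
    -- representatives of all the distinct `q`-cyclotomic cosets modulo `ℓ ^ m`
    (e : ℕ) (ρ : Fin (e + 1) → ZMod (ℓ ^ m)) (hρ0 : ρ 0 = 0)
    (hρ : ∀ x : ZMod (ℓ ^ m), ∃! i, x ∈ cyclotomicCoset q (ρ i))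
    (lam : Fˣ) :
    -- case (A)
    (lam ∈ Subgroup.zpowers (ξ ^ 2) →
      (∃ a : Fˣ, a ^ (2 * ℓ ^ m * p ^ n) * lam = 1) ∧
      ∀ a : Fˣ, a ^ (2 * ℓ ^ m * p ^ n) * lam = 1 →
      ∀ D : Submodule F (Fin (2 * ℓ ^ m * p ^ n) → F), IsConstacyclic (lam : F) D →
        (∃ ε ε' : Fin (e + 1) → ℕ, (∀ i, ε i ≤ p ^ n ∧ ε' i ≤ p ^ n) ∧
          IsGeneratorPoly (lam : F) D
            (∏ i, hatScale (polyM F η (ρ i)) (a : F) ^ ε i *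
              hatScale (polyM F η (ρ i)) (-(a : F)) ^ ε' i)) ∧
        ∀ ε ε' : Fin (e + 1) → ℕ, (∀ i, ε i ≤ p ^ n ∧ ε' i ≤ p ^ n) →
          IsGeneratorPoly (lam : F) D
            (∏ i, hatScale (polyM F η (ρ i)) (a : F) ^ ε i *
              hatScale (polyM F η (ρ i)) (-(a : F)) ^ ε' i) →
          IsConstacyclic (lam : F)⁻¹ (dualCode D) ∧
          IsGeneratorPoly (lam : F)⁻¹ (dualCode D)
            (∏ i, hatScale (polyM F η (-ρ i)) (a : F)⁻¹ ^ (p ^ n - ε i) *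
              hatScale (polyM F η (-ρ i)) (-(a : F)⁻¹) ^ (p ^ n - ε' i))) ∧
    -- case (B)
    (lam ∉ Subgroup.zpowers (ξ ^ 2) →
      (∃ b : Fˣ, b ^ (2 * ℓ ^ m * p ^ n) * lam = ξ ^ p ^ n) ∧
      ∀ b : Fˣ, b ^ (2 * ℓ ^ m * p ^ n) * lam = ξ ^ p ^ n →
      ∀ D : Submodule F (Fin (2 * ℓ ^ m * p ^ n) → F), IsConstacyclic (lam : F) D →
        -- case (B1)
        (Odd (orderOf (q : ZMod ℓ)) →
          (∃ ε : Fin (e + 1) → ℕ, (∀ i, ε i ≤ p ^ n) ∧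
            IsGeneratorPolyOver (lam : F) D
              (∏ i, hatScale (polyS F η β₁ (ρ i)) (algebraMap F K b) ^ ε i)) ∧
          ∀ ε : Fin (e + 1) → ℕ, (∀ i, ε i ≤ p ^ n) →
            IsGeneratorPolyOver (lam : F) D
              (∏ i, hatScale (polyS F η β₁ (ρ i)) (algebraMap F K b) ^ ε i) →
            IsConstacyclic (lam : F)⁻¹ (dualCode D) ∧
            IsGeneratorPolyOver (lam : F)⁻¹ (dualCode D)
              (∏ i, hatScale (polyS F η β₁⁻¹ (-ρ i)) (algebraMap F K b)⁻¹ ^ (p ^ n - ε i))) ∧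
        -- case (B2)
        (Even (orderOf (q : ZMod ℓ)) →
          (∃ (ε₀ : ℕ) (ε ε' : Fin e → ℕ), ε₀ ≤ p ^ n ∧ (∀ i, ε i ≤ p ^ n ∧ ε' i ≤ p ^ n) ∧
            IsGeneratorPolyOver (lam : F) D
              (hatScale ((X - C β₁⁻¹) * (X + C β₁⁻¹)) (algebraMap F K b) ^ ε₀ *
                ∏ i : Fin e, hatScale (polyQ q η β₁ (ρ i.succ)) (algebraMap F K b) ^ ε i *
                  hatScale (polyR q η β₁ (ρ i.succ)) (algebraMap F K b) ^ ε' i)) ∧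
          ∀ (ε₀ : ℕ) (ε ε' : Fin e → ℕ), ε₀ ≤ p ^ n → (∀ i, ε i ≤ p ^ n ∧ ε' i ≤ p ^ n) →
            IsGeneratorPolyOver (lam : F) D
              (hatScale ((X - C β₁⁻¹) * (X + C β₁⁻¹)) (algebraMap F K b) ^ ε₀ *
                ∏ i : Fin e, hatScale (polyQ q η β₁ (ρ i.succ)) (algebraMap F K b) ^ ε i *
                  hatScale (polyR q η β₁ (ρ i.succ)) (algebraMap F K b) ^ ε' i) →
            IsConstacyclic (lam : F)⁻¹ (dualCode D) ∧
            IsGeneratorPolyOver (lam : F)⁻¹ (dualCode D)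
              (hatScale ((X - C β₁) * (X + C β₁)) (algebraMap F K b)⁻¹ ^ (p ^ n - ε₀) *
                ∏ i : Fin e,
                  hatScale (polyQ q η β₁⁻¹ (-ρ i.succ)) (algebraMap F K b)⁻¹ ^ (p ^ n - ε i) *
                  hatScale (polyR q η β₁⁻¹ (-ρ i.succ)) (algebraMap F K b)⁻¹ ^
                    (p ^ n - ε' i)))) := by
  subst hq
  have hpp : p.Prime := Fact.out
  have hℓℓ : ℓ.Prime := Fact.out
  have : CharP K p := charP_of_injective_algebraMap (algebraMap F K).injective p
  have hF : Odd (Fintype.card F) := by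
    obtain ⟨k, -, hk⟩ := FiniteField.card F p
    rw [hk]; exact hp.pow
  have hℓF : ¬ℓ ∣ Fintype.card F := by
    obtain ⟨k, -, hk⟩ := FiniteField.card F p
    rw [hk]
    exact fun h => hℓp ((Nat.prime_dvd_prime_iff_eq hℓℓ hpp).1 (hℓℓ.dvd_of_dvd_pow h))
  have hkK : ((ℓ ^ m : ℕ) : K) ≠ 0 := by
    rw [Ne, CharP.cast_eq_zero_iff K p]
    exact fun h => hℓp ((Nat.prime_dvd_prime_iff_eq hpp hℓℓ).1 (hpp.dvd_of_dvd_pow h)).symm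
  have h2K : ((2 : ℕ) : K) ≠ 0 := by
    rw [Ne, CharP.cast_eq_zero_iff K p, Nat.prime_dvd_prime_iff_eq hpp Nat.prime_two]
    rintro rfl
    exact absurd hp (by decide)
  have h2k : ((2 * ℓ ^ m : ℕ) : K) ≠ 0 := by
    rw [Nat.cast_mul]; exact mul_ne_zero h2K hkK
  have hcard := card_units_coprime (F := F) p ℓ m n hcop
  have hβ0 : β₁ ≠ 0 := by
    rintro rfl
    rw [zero_pow (pow_ne_zero _ hℓℓ.ne_zero), zero_mul] at hαβ
    exact zero_ne_one hαβ
  refine ⟨fun hlam => ⟨?_, fun a ha D hD => ?_⟩, fun hlam => ⟨?_, fun b hb D hD => ?_⟩⟩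
  · rw [mul_assoc]
    exact exists_pow_mul_eq_one_of_mem_zpowers_sq hcard hlam
  · have hdata : RootData F p n (ℓ ^ m) η (algebraMap F K (a : F)) (lam : F) :=
      ⟨inferInstance, inferInstance, hℓ.pow, h2k, hη, by
        rw [← map_pow, ← map_mul, ← Units.val_pow_eq_pow_val, ← Units.val_mul, ha]; simp⟩
    have key := hdata.isGeneratorPolyOver_of_pow_card_eq
      (by rw [← map_pow, FiniteField.pow_card]) hF hρ D hD
    -- The inverse is taken in `F`, so that the dual generator too is the image of a polynomial over
    -- `F`.
    rw [← map_inv₀] at key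
    simpa only [← map_prod_hatScale_polyM hη hkK _ a.ne_zero,
      ← map_prod_hatScale_polyM hη hkK _ (inv_ne_zero a.ne_zero),
      isGeneratorPolyOver_map_iff] using key
  · rw [mul_assoc]
    exact exists_pow_mul_eq_pow_of_notMem_zpowers_sq hcard hp.pow (hξ lam) hlam
  · have hb0 : algebraMap F K (b : F) ≠ 0 := by simp
    have hγ : (β₁ * algebraMap F K (b : F)) ^ Fintype.card F = -(β₁ * algebraMap F K (b : F)) := by
      rw [mul_pow, ← map_pow, FiniteField.pow_card,
        hβ₁.pow_eq_neg_of_two_mul Fintype.one_lt_card, neg_mul]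
    have hdata : RootData F p n (ℓ ^ m) η (β₁ * algebraMap F K (b : F)) (lam : F) :=
      ⟨inferInstance, inferInstance, hℓ.pow, h2k, hη, by
        have hb' := congrArg (fun x : Fˣ => algebraMap F K (x : F)) hb
        simp only [Units.val_mul, Units.val_pow_eq_pow_val, map_mul, map_pow, ← hα₁] at hb'
        -- Since ξ = α₁², the left side is (β₁^(ℓ^m) · α₁)^(2p^n) = 1.
        rw [mul_pow, mul_assoc, hb', ← pow_mul,
          show 2 * ℓ ^ m * p ^ n = ℓ ^ m * (2 * p ^ n) by ring, pow_mul, ← mul_pow, hαβ, one_pow]⟩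
    refine ⟨fun ho => ?_, fun he => ?_⟩
    · obtain ⟨T, hT, hqT⟩ := exists_odd_pow_eq_one hm hℓ ho
      have key := hdata.isGeneratorPolyOver_of_odd hγ hF hρ hT hqT D hD
      simpa only [hatScale_polyS hη hkK _ hβ0 hb0,
        hatScale_polyS hη hkK _ (inv_ne_zero hβ0) (inv_ne_zero hb0), ← mul_inv] using key
    · have key := hdata.isGeneratorPolyOver_of_even hγ hF hρ0 hρ hℓF he D hD
      have hP := hatScale_X_sub_C_mul_X_add_C (k := ℓ ^ m) η (β := β₁) hb0
      -- P* is P with β₁⁻¹ in place of β₁.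
      have hP' := hatScale_X_sub_C_mul_X_add_C (k := ℓ ^ m) η (β := β₁⁻¹) (inv_ne_zero hb0)
      rw [inv_inv] at hP'
      simpa only [hP, hP', hatScale_polyQ _ _ hβ0 hb0, hatScale_polyR _ _ hβ0 hb0,
        hatScale_polyQ _ _ (inv_ne_zero hβ0) (inv_ne_zero hb0),
        hatScale_polyR _ _ (inv_ne_zero hβ0) (inv_ne_zero hb0), ← mul_inv] using key
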